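/- Let $K$ be a field of characteristic different from $2$. A superalgebra is a (nonassociative, not necessarily unital) $K$-algebra $A=A_0\oplus A_1$ with $A_iA_j\subseteq A_{i+j\,(\mathrm{mod}\,2)}$; it is bicommutative if \[ x(yz)=(-1)^{\overline{x}\,\overline{y}}\,y(xz),\qquad (xy)z=(-1)^{\overline{y}\,\overline{z}}\,(xz)y \] for all homogeneous $x,y,z\in A$, where $\overline{u}\in\{0,1\}$ is the parity of $u$. For a finite system $S$ of generators of an algebra $A$ with span $V$, let $g_V(n)=\dim(V^0+V^1+\cdots+V^n)$, where for $k\ge 1$ the space $V^k$ is spanned by all products of $k$ elements of $V$ with arbitrary arrangement of parentheses, and $V^0=K\cdot 1$ if $A$ is unital, $V^0=0$ otherwise. The Gelfand–Kirillov dimension is \[ \mathrm{GKdim}(A)=\limsup_{n\to\infty}\log_n g_V(n) \] (with the convention $\log_n 0=0$, which matters only for $A=0$ and gives $\mathrm{GKdim}(0)=0$). **Theorem.** For every finitely generated bicommutative superalgebra $A$ over $K$ there is an integer $d\ge 0$ such that $\mathrm{GKdim}(A)=d$, whichever finite system of generators is used to compute it. Moreover, for all integers $p,q\ge 0$, the free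 bicommutative superalgebra $F_{p,q}$ on $p$ even and $q$ odd generators is finitely generated and, again for every finite system of generators, $\mathrm{GKdim}(F_{p,q})=2p$. -/

import Mathlib

universe u v

section Superalgebras

variable {K : Type u} [Field K] {A : Type v} [NonUnitalNonAssocRing A] [Module K A]

/-- A grading `A = 𝒜 0 ⊕ 𝒜 1` by `ℤ/2` making the (nonassociative, not necessarily unital)
algebra `A` a superalgebra. -/
structure IsSuperalgebra (𝒜 : ZMod 2 → Submodule K A) : Prop where
  isInternal : DirectSum.IsInternal 𝒜
  mul_mem : ∀ (i j : ZMod 2) (a b : A), a ∈ 𝒜 i → b ∈ 𝒜 j → a * b ∈ 𝒜 (i + j)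

/-- A superalgebra whose homogeneous elements satisfy super-left-commutativity
`x (y z) = (-1)^(|x| |y|) y (x z)` and super-right-commutativity
`(x y) z = (-1)^(|y| |z|) (x z) y`. -/
structure IsBicommutativeSuperalgebra (𝒜 : ZMod 2 → Submodule K A) : Prop
    extends IsSuperalgebra 𝒜 where
  left_comm : ∀ (i j k : ZMod 2) (x y z : A), x ∈ 𝒜 i → y ∈ 𝒜 j → z ∈ 𝒜 k →
    x * (y * z) = (-1 : K) ^ (i.val * j.val) • (y * (x * z))
  right_comm : ∀ (i j k : ZMod 2) (x y z : A), x ∈ 𝒜 i → y ∈ 𝒜 j → z ∈ 𝒜 k →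
    (x * y) * z = (-1 : K) ^ (j.val * k.val) • ((x * z) * y)

end Superalgebras

section GelfandKirillov

/-- The set of two-sided identity elements: `{1}` if `A` is unital, and `∅` otherwise. -/
def identityElements (A : Type v) [Mul A] : Set A := {e | ∀ a : A, e * a = a ∧ a * e = a}

variable (K : Type u) [Field K] {A : Type v} [NonUnitalNonAssocRing A] [Module K A]

/-- For `n ≥ 1`, `V ^ n` is spanned by all products of `n` elements of `V` with arbitrary
arrangements of parentheses, i.e. by the values of the nonassociative words of length `n` in
elements of `V`; `V ^ 0` is `K 1` if `A` is unital and `0` otherwise. -/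
noncomputable def submodulePower (V : Submodule K A) : ℕ → Submodule K A
  | 0 => Submodule.span K (identityElements A)
  | n + 1 => Submodule.span K
      {x | ∃ w : FreeMagma V, w.length = n + 1 ∧ FreeMagma.lift (fun v : V => (v : A)) w = x}

/-- The growth function `g_V(n) = dim (V ^ 0 + V ^ 1 + ⋯ + V ^ n)`, where `V` is the span of `S`. -/
noncomputable def growthFunction (S : Finset A) (n : ℕ) : ℕ :=
  Module.finrank K
    (⨆ k ∈ Finset.range (n + 1), submodulePower K (Submodule.span K (S : Set A)) k :
      Submodule K A)

/-- `limsup_{n → ∞} log_n (g_V(n))`, where `V` is the span of `S`. For the zero algebra, where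
`g_V = 0`, the convention `log_n 0 = 0` gives the value `0`. -/
noncomputable def growthExponent (S : Finset A) : EReal :=
  Filter.limsup (fun n : ℕ => ((Real.logb (n : ℝ) (growthFunction K S n : ℝ) : ℝ) : EReal))
    Filter.atTop

variable [IsScalarTower K A A] [SMulCommClass K A A]

/-- `S` generates `A` as an algebra (as a unital algebra in case `A` happens to be unital). -/
def IsGeneratingSystem (S : Finset A) : Prop :=
  NonUnitalAlgebra.adjoin K ((S : Set A) ∪ identityElements A) = ⊤

variable (A)

/-- `A` is a finitely generated algebra. -/
def IsFinitelyGenerated : Prop := ∃ S : Finset A, IsGeneratingSystem K S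

/-- The algebra `A` is finitely generated and its Gelfand-Kirillov dimension, computed with any
finite system of generators whatsoever, is equal to `d`. -/
def HasGKDim (d : EReal) : Prop :=
  IsFinitelyGenerated K A ∧ ∀ S : Finset A, IsGeneratingSystem K S → growthExponent K S = d

end GelfandKirillov

section FreeBicommutative

/-- The nonassociative monomials in `p` even and `q` odd variables. -/
abbrev SuperMonomial (p q : ℕ) : Type := FreeMagma (Fin p ⊕ Fin q)

/-- The parity of a monomial: the number of odd variables in it, modulo 2. -/
def SuperMonomial.parity {p q : ℕ} : SuperMonomial p q → ZMod 2
  | .of (.inl _) => 0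
  | .of (.inr _) => 1
  | .mul x y => SuperMonomial.parity x + SuperMonomial.parity y

variable (K : Type u) [Field K] (p q : ℕ)

/-- The value of a monomial in the absolutely free nonassociative algebra. -/
noncomputable def SuperMonomial.toFree :
    SuperMonomial p q →ₙ* FreeNonUnitalNonAssocAlgebra K (Fin p ⊕ Fin q) :=
  FreeMagma.lift (FreeNonUnitalNonAssocAlgebra.of K)

/-- The super-left- and super-right-commutativity relations between monomials. -/
def bicommutativeRelations : Set (FreeNonUnitalNonAssocAlgebra K (Fin p ⊕ Fin q)) :=
  {r | ∃ x y z : SuperMonomial p q,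
    r = SuperMonomial.toFree K p q (x * (y * z)) -
      (-1 : K) ^ (x.parity.val * y.parity.val) • SuperMonomial.toFree K p q (y * (x * z)) ∨
    r = SuperMonomial.toFree K p q ((x * y) * z) -
      (-1 : K) ^ (y.parity.val * z.parity.val) • SuperMonomial.toFree K p q ((x * z) * y)}

/-- The two-sided ideal generated by the relations. -/
noncomputable def bicommutativeIdeal :
    Submodule K (FreeNonUnitalNonAssocAlgebra K (Fin p ⊕ Fin q)) :=
  sInf {J | bicommutativeRelations K p q ⊆ J ∧ ∀ a b, b ∈ J → a * b ∈ J ∧ b * a ∈ J}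

theorem bicommutativeIdeal_mul_mem (a b : FreeNonUnitalNonAssocAlgebra K (Fin p ⊕ Fin q))
    (hb : b ∈ bicommutativeIdeal K p q) :
    a * b ∈ bicommutativeIdeal K p q ∧ b * a ∈ bicommutativeIdeal K p q := by
  simp only [bicommutativeIdeal, Submodule.mem_sInf] at hb ⊢
  exact ⟨fun J hJ => (hJ.2 a b (hb J hJ)).1, fun J hJ => (hJ.2 a b (hb J hJ)).2⟩

/-- The free bicommutative superalgebra generated by `p` even and `q` odd variables. -/
def FreeBicommutativeSuperalgebra : Type u :=
  FreeNonUnitalNonAssocAlgebra K (Fin p ⊕ Fin q) ⧸ bicommutativeIdeal K p q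

namespace FreeBicommutativeSuperalgebra

noncomputable instance : AddCommGroup (FreeBicommutativeSuperalgebra K p q) :=
  inferInstanceAs (AddCommGroup (_ ⧸ bicommutativeIdeal K p q))

noncomputable instance : Module K (FreeBicommutativeSuperalgebra K p q) :=
  inferInstanceAs (Module K (_ ⧸ bicommutativeIdeal K p q))

/-- The quotient map from the absolutely free algebra. -/
noncomputable def mk : FreeNonUnitalNonAssocAlgebra K (Fin p ⊕ Fin q) →ₗ[K]
    FreeBicommutativeSuperalgebra K p q :=
  (bicommutativeIdeal K p q).mkQ

theorem mk_surjective : Function.Surjective (mk K p q) :=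
  (bicommutativeIdeal K p q).mkQ_surjective

theorem mk_eq_mk_iff (a b : FreeNonUnitalNonAssocAlgebra K (Fin p ⊕ Fin q)) :
    mk K p q a = mk K p q b ↔ a - b ∈ bicommutativeIdeal K p q :=
  Submodule.Quotient.eq _

/-- Multiplication is induced from the absolutely free algebra, see `mk_mul`. -/
noncomputable instance : Mul (FreeBicommutativeSuperalgebra K p q) where
  mul x y := mk K p q ((mk_surjective K p q x).choose * (mk_surjective K p q y).choose)

theorem mk_mul (a b : FreeNonUnitalNonAssocAlgebra K (Fin p ⊕ Fin q)) :
    mk K p q (a * b) = mk K p q a * mk K p q b := by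
  have ha := (mk_eq_mk_iff K p q _ _).1 (mk_surjective K p q (mk K p q a)).choose_spec
  have hb := (mk_eq_mk_iff K p q _ _).1 (mk_surjective K p q (mk K p q b)).choose_spec
  refine Eq.symm ((mk_eq_mk_iff K p q _ _).2 ?_)
  have h := add_mem (bicommutativeIdeal_mul_mem K p q
    (mk_surjective K p q (mk K p q b)).choose _ ha).2
    (bicommutativeIdeal_mul_mem K p q a _ hb).1
  rwa [sub_mul, mul_sub, sub_add_sub_cancel] at h

noncomputable instance : NonUnitalNonAssocRing (FreeBicommutativeSuperalgebra K p q) :=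
  { (inferInstance : AddCommGroup (FreeBicommutativeSuperalgebra K p q)),
    (inferInstance : Mul (FreeBicommutativeSuperalgebra K p q)) with
    left_distrib := fun x y z => by
      obtain ⟨a, rfl⟩ := mk_surjective K p q x
      obtain ⟨b, rfl⟩ := mk_surjective K p q y
      obtain ⟨c, rfl⟩ := mk_surjective K p q z
      rw [← map_add, ← mk_mul, ← mk_mul, ← mk_mul, ← map_add, mul_add]
    right_distrib := fun x y z => by
      obtain ⟨a, rfl⟩ := mk_surjective K p q x
      obtain ⟨b, rfl⟩ := mk_surjective K p q y
      obtain ⟨c, rfl⟩ := mk_surjective K p q z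
      rw [← map_add, ← mk_mul, ← mk_mul, ← mk_mul, ← map_add, add_mul]
    zero_mul := fun x => by
      obtain ⟨a, rfl⟩ := mk_surjective K p q x
      rw [← map_zero (mk K p q), ← mk_mul, zero_mul]
    mul_zero := fun x => by
      obtain ⟨a, rfl⟩ := mk_surjective K p q x
      rw [← map_zero (mk K p q), ← mk_mul, mul_zero] }

instance : IsScalarTower K (FreeBicommutativeSuperalgebra K p q)
    (FreeBicommutativeSuperalgebra K p q) where
  smul_assoc k x y := by
    obtain ⟨a, rfl⟩ := mk_surjective K p q x
    obtain ⟨b, rfl⟩ := mk_surjective K p q y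
    rw [smul_eq_mul, smul_eq_mul, ← map_smul, ← mk_mul, ← mk_mul, ← map_smul, smul_mul_assoc]

instance : SMulCommClass K (FreeBicommutativeSuperalgebra K p q)
    (FreeBicommutativeSuperalgebra K p q) where
  smul_comm k x y := by
    obtain ⟨a, rfl⟩ := mk_surjective K p q x
    obtain ⟨b, rfl⟩ := mk_surjective K p q y
    rw [smul_eq_mul, smul_eq_mul, ← map_smul, ← mk_mul, ← mk_mul, ← map_smul, mul_smul_comm]

end FreeBicommutativeSuperalgebra

end FreeBicommutative

/-! Splitting generators into homogeneous parts, take `A` generated by finitely many even and odd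
elements. On the square `A ^ 2`, left multiplications by generators supercommute, right
multiplications supercommute, and every left multiplication commutes with every right one
(`lift_mul_mul_lift`). Every product of at least two generators is a scalar multiple of a product of
two generators acted on by such multiplications (`hasNormalForm_aux`).

The multiplications by `p` even generators thus make `A ^ 2` a module over a polynomial ring in `2
p` variables. The odd ones anticommute, and square to zero because the characteristic is not `2`, so
only finitely many operators arise as words in them; hence `A ^ 2` is a finitely generated module
(`finite_oddGenerators`, `span_oddGenerators_eq_top`). Up to bounded changes, `g_V` is the growth of
its degree filtration.

Noether normalization of the polynomial ring modulo the annihilator turns a nonzero finitely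
generated module into a finite faithful module over a polynomial ring in `d` variables, whose growth
is of order `n ^ d` (`exists_hasPolynomialGrowth_polyFiltration`). Different generating systems give
growth functions that agree up to rescaling the argument, so the exponent does not depend on the
choice.

For the free superalgebra, the `2 p` variables give the upper bound `2 p`. The lower bound comes
from a map to pairs of polynomials in `2 p` variables that kills the odd generators, where left and
right multiplications by even generators act as independent variables. -/

set_option linter.unusedSectionVars false

/-! ### Polynomial growth and the limsup of logarithms -/

section PolynomialGrowth

open Filter Topology

/-- The function `g` grows like `n ^ d`, up to rescaling of the argument and of the value. -/
def HasPolynomialGrowth (g : ℕ → ℕ) (d : ℕ) : Prop :=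
  ∃ C : ℕ, (∀ n, g n ≤ C * (n + 1) ^ d) ∧ (d = 0 ∨ ∀ n, n ^ d ≤ C * g (C * (n + 1)))

/-- The exponent ignores linear rescaling of the argument and a bounded additive error; the latter
leaves room for the identity element and the generators themselves, which lie outside the module
whose growth is computed. -/
theorem HasPolynomialGrowth.of_comparable {g₁ g₂ : ℕ → ℕ} {d : ℕ} (h : HasPolynomialGrowth g₂ d)
    (hg₁ : Monotone g₁) {a c : ℕ} (h₁ : ∀ n, g₁ n ≤ a + g₂ (c * (n + 1)))
    (h₂ : ∀ n, g₂ n ≤ g₁ (c * (n + 1))) : HasPolynomialGrowth g₁ d := by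
  obtain ⟨C, hC, hC'⟩ := h
  refine ⟨a + C * (c + 1) ^ d + (C + c * (C + 1)), fun n => ?_, hC'.imp_right fun hC' n => ?_⟩
  · have h3 : (c * (n + 1) + 1) ^ d ≤ (c + 1) ^ d * (n + 1) ^ d := by
      rw [← mul_pow]; exact Nat.pow_le_pow_left (by nlinarith) _
    have h4 : 1 ≤ (n + 1) ^ d := Nat.one_le_pow _ _ (by omega)
    calc g₁ n ≤ a + C * (c * (n + 1) + 1) ^ d := (h₁ n).trans (by gcongr; exact hC _)
      _ ≤ a * (n + 1) ^ d + C * ((c + 1) ^ d * (n + 1) ^ d) := by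
          gcongr
          exact Nat.le_mul_of_pos_right _ h4
      _ = (a + C * (c + 1) ^ d) * (n + 1) ^ d := by ring
      _ ≤ _ := Nat.mul_le_mul_right _ (Nat.le_add_right _ _)
  · calc n ^ d ≤ C * g₂ (C * (n + 1)) := hC' n
      _ ≤ C * g₁ (c * (C * (n + 1) + 1)) := by gcongr; exact h₂ _
      _ ≤ _ := by
        have h5 : c * (C * (n + 1) + 1) ≤ c * (C + 1) * (n + 1) := by
          rw [mul_assoc]; gcongr; nlinarith
        refine Nat.mul_le_mul (by omega) (hg₁ (h5.trans ?_))
        gcongr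
        omega

theorem tendsto_const_add_div_log (a b : ℝ) :
    Tendsto (fun n : ℕ => ((a + b / Real.log n : ℝ) : EReal)) atTop (𝓝 (a : EReal)) := by
  refine (continuous_coe_real_ereal.tendsto a).comp ?_
  have h : Tendsto (fun n : ℕ => b / Real.log n) atTop (𝓝 0) :=
    tendsto_const_nhds.div_atTop (Real.tendsto_log_atTop.comp tendsto_natCast_atTop_atTop)
  simpa using tendsto_const_nhds.add h

theorem logb_mul_pow {n : ℕ} (hn : 2 ≤ n) {C : ℝ} (hC : 0 < C) (d : ℕ) :
    Real.logb n (C * (n : ℝ) ^ d) = d + Real.log C / Real.log n := by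
  have hn' : (0 : ℝ) < n := by positivity
  have hl : Real.log n ≠ 0 := (Real.log_pos (by exact_mod_cast hn)).ne'
  rw [Real.logb, Real.log_mul hC.ne' (by positivity), Real.log_pow]
  field_simp
  ring

/-- A constant factor changes `log_n` by `O(1 / log n)`. The lower estimate is available only at the
arguments `C * (n + 1)`, but a limsup is bounded below by its value along any sequence tending to
infinity. -/
theorem HasPolynomialGrowth.limsup_logb {g : ℕ → ℕ} {d : ℕ} (h : HasPolynomialGrowth g d) :
    limsup (fun n : ℕ => ((Real.logb (n : ℝ) (g n : ℝ) : ℝ) : EReal)) atTop = (d : EReal) := by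
  obtain ⟨C, hC, hC'⟩ := h
  have hd : (d : EReal) = ((d : ℝ) : EReal) := rfl
  have hnonneg : ∀ n : ℕ, 2 ≤ n → 0 ≤ Real.logb (n : ℝ) (g n : ℝ) := by
    intro n hn
    rcases Nat.eq_zero_or_pos (g n) with h0 | h0
    · simp [h0]
    · exact Real.logb_nonneg (by exact_mod_cast hn) (by exact_mod_cast h0)
  apply le_antisymm
  · rw [hd, ← (tendsto_const_add_div_log d (Real.log ((C + 1) * 2 ^ d))).limsup_eq]
    refine limsup_le_limsup ?_
    filter_upwards [eventually_ge_atTop 2] with n hn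
    rw [EReal.coe_le_coe_iff, ← logb_mul_pow hn (by positivity)]
    have hb : (g n : ℝ) ≤ (C + 1) * 2 ^ d * (n : ℝ) ^ d := by
      have h1 : g n ≤ (C + 1) * (2 * n) ^ d :=
        (hC n).trans (Nat.mul_le_mul (by omega) (Nat.pow_le_pow_left (by omega) _))
      have h2 : (g n : ℝ) ≤ (C + 1) * (2 * n) ^ d := by exact_mod_cast h1
      rwa [mul_pow, ← mul_assoc] at h2
    rcases Nat.eq_zero_or_pos (g n) with h0 | h0
    · rw [h0]
      simp only [Nat.cast_zero, Real.logb_zero]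
      apply Real.logb_nonneg (by exact_mod_cast hn)
      have h3 : (1 : ℝ) ≤ (C + 1) := by simp
      have h4 : (1 : ℝ) ≤ 2 ^ d := one_le_pow₀ (by norm_num)
      have h5 : (1 : ℝ) ≤ (n : ℝ) ^ d := one_le_pow₀ (by exact_mod_cast (by omega : 1 ≤ n))
      exact one_le_mul_of_one_le_of_one_le (one_le_mul_of_one_le_of_one_le h3 h4) h5
    · exact Real.logb_le_logb_of_le (by exact_mod_cast hn) (by exact_mod_cast h0) hb
  · rcases hC' with rfl | hC'
    -- For exponent `0` no lower bound on `g` is assumed: the logarithm of a natural number is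
    -- nonnegative, including `logb n 0 = 0`.
    · refine le_limsup_of_frequently_le' (Eventually.frequently ?_)
      filter_upwards [eventually_ge_atTop 2] with n hn
      exact_mod_cast hnonneg n hn
    · have hCpos : 0 < C := by
        rcases Nat.eq_zero_or_pos C with rfl | h0
        · simpa using hC' 1
        · exact h0
      have hu : Tendsto (fun n : ℕ => C * (n + 1)) atTop atTop :=
        tendsto_atTop_mono (fun n => show n ≤ _ by nlinarith) tendsto_id
      rw [hd, ← ((tendsto_const_add_div_log d
        (Real.log ((C * (2 * C) ^ d : ℝ)⁻¹))).comp hu).limsup_eq]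
      refine le_trans (limsup_le_limsup (v := fun n : ℕ =>
        ((Real.logb ((C * (n + 1) : ℕ) : ℝ) (g (C * (n + 1)) : ℝ) : ℝ) : EReal)) ?_)
        (limsup_le_limsup_of_le (f := map (fun n : ℕ => C * (n + 1)) atTop)
        (u := fun n : ℕ => ((Real.logb (n : ℝ) (g n : ℝ) : ℝ) : EReal)) hu)
      filter_upwards [eventually_ge_atTop 1] with n hn
      have hm : 2 ≤ C * (n + 1) := by nlinarith
      rw [Function.comp_apply, EReal.coe_le_coe_iff, ← logb_mul_pow hm (by positivity)]
      refine Real.logb_le_logb_of_le (by exact_mod_cast hm) (by positivity) ?_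
      have h1 : (C * (n + 1)) ^ d ≤ (C * (2 * C) ^ d) * g (C * (n + 1)) := by
        calc (C * (n + 1)) ^ d ≤ (2 * C * n) ^ d := Nat.pow_le_pow_left (by nlinarith) _
          _ = (2 * C) ^ d * n ^ d := mul_pow _ _ _
          _ ≤ (2 * C) ^ d * (C * g (C * (n + 1))) := by gcongr; exact hC' n
          _ = _ := by ring
      rw [inv_mul_le_iff₀ (by positivity)]
      exact_mod_cast h1

end PolynomialGrowth

/-! ### Growth of finitely generated modules over polynomial rings -/

section FilteredModules

open MvPolynomial Submodule

variable {K : Type u} [Field K] {σ τ : Type*} {M : Type v} [AddCommGroup M] [Module K M]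
  [Module (MvPolynomial σ K) M]

theorem monomial_smul_mem {F : ℕ → Submodule K M} {c : ℕ}
    (hF : ∀ i k m, m ∈ F k → (X i : MvPolynomial σ K) • m ∈ F (k + c)) (s : σ →₀ ℕ) :
    ∀ k m, m ∈ F k → monomial s (1 : K) • m ∈ F (k + c * s.degree) := by
  induction s using Finsupp.induction_linear with
  | zero =>
    intro k m hm
    simpa [← C_apply] using hm
  | add s t hs ht =>
    intro k m hm
    have h := ht _ _ (hs _ _ hm)
    rw [smul_smul, monomial_mul, one_mul, add_comm t s] at h
    rwa [map_add, mul_add, ← add_assoc]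
  | single i n =>
    rw [← X_pow_eq_monomial, Finsupp.degree_single]
    induction n with
    | zero =>
      intro k m hm
      simpa using hm
    | succ n ih =>
      intro k m hm
      have h := hF i _ _ (ih _ _ hm)
      rw [smul_smul, ← pow_succ'] at h
      rwa [mul_add, mul_one, ← add_assoc]

theorem smul_mem_of_forall_monomial [IsScalarTower K (MvPolynomial σ K) M] {N : Submodule K M}
    {f : MvPolynomial σ K} {m : M} (h : ∀ s ∈ f.support, monomial s (1 : K) • m ∈ N) :
    f • m ∈ N := by
  rw [f.as_sum, Finset.sum_smul]
  refine sum_mem fun s hs => ?_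
  have h1 : monomial s (coeff s f) = coeff s f • monomial s (1 : K) := by
    rw [smul_monomial, smul_eq_mul, mul_one]
  rw [h1, smul_assoc]
  exact N.smul_mem _ (h s hs)

theorem smul_mem_of_totalDegree_le [IsScalarTower K (MvPolynomial σ K) M]
    {F : ℕ → Submodule K M} (hmono : Monotone F) {c : ℕ}
    (hF : ∀ i k m, m ∈ F k → (X i : MvPolynomial σ K) • m ∈ F (k + c))
    {f : MvPolynomial σ K} {n : ℕ} (hf : f.totalDegree ≤ n) {k : ℕ} {m : M} (hm : m ∈ F k) :
    f • m ∈ F (k + c * n) :=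
  smul_mem_of_forall_monomial fun s hs => hmono
    (by gcongr; exact (le_totalDegree hs).trans hf) (monomial_smul_mem hF s k m hm)

variable (K σ) in
/-- The span of the multiples `f • g` with `g ∈ G` and `f` of degree at most `n`. -/
def polyFiltration (G : Finset M) (n : ℕ) : Submodule K M :=
  span K {x | ∃ f : MvPolynomial σ K, f.totalDegree ≤ n ∧ ∃ g ∈ G, f • g = x}

theorem polyFiltration_mono (G : Finset M) : Monotone (polyFiltration K σ G) :=
  fun _ _ h => span_mono fun _ ⟨f, hf, hx⟩ => ⟨f, hf.trans h, hx⟩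

theorem smul_mem_polyFiltration {G : Finset M} {f : MvPolynomial σ K} {n : ℕ}
    (hf : f.totalDegree ≤ n) {g : M} (hg : g ∈ G) : f • g ∈ polyFiltration K σ G n :=
  subset_span ⟨f, hf, g, hg, rfl⟩

theorem mem_polyFiltration_zero {G : Finset M} {g : M} (hg : g ∈ G) :
    g ∈ polyFiltration K σ G 0 := by
  simpa using smul_mem_polyFiltration (f := (1 : MvPolynomial σ K)) (n := 0) (by simp) hg

theorem smul_mem_polyFiltration_add [IsScalarTower K (MvPolynomial σ K) M] {G : Finset M}
    {f : MvPolynomial σ K} {n k : ℕ} (hf : f.totalDegree ≤ n) {m : M}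
    (hm : m ∈ polyFiltration K σ G k) : f • m ∈ polyFiltration K σ G (k + n) := by
  have := IsScalarTower.to_smulCommClass (R := K) (A := MvPolynomial σ K) (M := M)
  induction hm using span_induction with
  | mem x hx =>
    obtain ⟨f', hf', g, hg, rfl⟩ := hx
    rw [smul_smul]
    exact smul_mem_polyFiltration ((totalDegree_mul _ _).trans (by omega)) hg
  | zero => simp
  | add x y _ _ hx hy => rw [smul_add]; exact add_mem hx hy
  | smul a x _ hx => rw [smul_comm]; exact Submodule.smul_mem _ _ hx

theorem exists_mem_polyFiltration [IsScalarTower K (MvPolynomial σ K) M] {G : Finset M}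
    (hG : span (MvPolynomial σ K) (G : Set M) = ⊤) (m : M) : ∃ n, m ∈ polyFiltration K σ G n := by
  have hm : m ∈ span (MvPolynomial σ K) (G : Set M) := hG ▸ mem_top
  induction hm using span_induction with
  | mem x hx => exact ⟨0, mem_polyFiltration_zero hx⟩
  | zero => exact ⟨0, zero_mem _⟩
  | add x y _ _ hx hy =>
    obtain ⟨a, ha⟩ := hx
    obtain ⟨b, hb⟩ := hy
    exact ⟨max a b, add_mem (polyFiltration_mono G (le_max_left _ _) ha)
      (polyFiltration_mono G (le_max_right _ _) hb)⟩
  | smul f x _ hx =>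
    obtain ⟨a, ha⟩ := hx
    exact ⟨_, smul_mem_polyFiltration_add le_rfl ha⟩

theorem exists_forall_mem_of_finite {α : Type*} [Finite α] {F : ℕ → Submodule K M}
    (hmono : Monotone F) (x : α → M) (hx : ∀ a, ∃ n, x a ∈ F n) : ∃ n, ∀ a, x a ∈ F n := by
  choose n hn using hx
  obtain ⟨b, hb⟩ := Set.finite_range n |>.bddAbove
  exact ⟨b, fun a => hmono (hb ⟨a, rfl⟩) (hn a)⟩

theorem polyFiltration_le_span_range [Fintype σ] [IsScalarTower K (MvPolynomial σ K) M]
    (G : Finset M) (n : ℕ) : polyFiltration K σ G n ≤ span K (Set.range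
      fun x : (σ → Fin (n + 1)) × G =>
        monomial (Finsupp.equivFunOnFinite.symm fun i => (x.1 i : ℕ)) (1 : K) • (x.2 : M)) := by
  rw [polyFiltration, span_le]
  rintro _ ⟨f, hf, g, hg, rfl⟩
  refine smul_mem_of_forall_monomial fun s hs => subset_span ?_
  refine ⟨⟨fun i => ⟨s i, Nat.lt_succ_of_le ?_⟩, ⟨g, hg⟩⟩, ?_⟩
  · exact (Finsupp.le_degree i s).trans ((le_totalDegree hs).trans hf)
  · exact congrArg (fun t => monomial t (1 : K) • g) (Finsupp.equivFunOnFinite.symm_apply_apply s)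

instance finiteDimensional_polyFiltration [Finite σ] [IsScalarTower K (MvPolynomial σ K) M]
    (G : Finset M) (n : ℕ) : FiniteDimensional K (polyFiltration K σ G n) := by
  have := Fintype.ofFinite σ
  have := FiniteDimensional.span_of_finite K (Set.finite_range
    fun x : (σ → Fin (n + 1)) × G =>
        monomial (Finsupp.equivFunOnFinite.symm fun i => (x.1 i : ℕ)) (1 : K) • (x.2 : M))
  exact finiteDimensional_of_le (polyFiltration_le_span_range G n)

theorem finrank_polyFiltration_le [Fintype σ] [IsScalarTower K (MvPolynomial σ K) M]
    (G : Finset M) (n : ℕ) :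
    Module.finrank K (polyFiltration K σ G n) ≤ G.card * (n + 1) ^ Fintype.card σ := by
  classical
  have := FiniteDimensional.span_of_finite K (Set.finite_range
    fun x : (σ → Fin (n + 1)) × G =>
        monomial (Finsupp.equivFunOnFinite.symm fun i => (x.1 i : ℕ)) (1 : K) • (x.2 : M))
  refine (finrank_mono (polyFiltration_le_span_range G n)).trans ((finrank_range_le_card _).trans ?_)
  simp [mul_comm]

variable (K σ) in
/-- The monomials with all exponents smaller than `n`. -/
theorem linearIndependent_boxMonomials [Finite σ] (n : ℕ) :
    LinearIndependent K fun s : σ → Fin n =>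
      (monomial (Finsupp.equivFunOnFinite.symm fun i => (s i : ℕ)) (1 : K) : MvPolynomial σ K) := by
  have h := (basisMonomials σ K).linearIndependent.comp
    (fun s : σ → Fin n => (Finsupp.equivFunOnFinite.symm fun i => (s i : ℕ) : σ →₀ ℕ))
    (fun s t hst => funext fun i => Fin.ext (congrFun (Finsupp.equivFunOnFinite.symm.injective hst) i))
  simpa [Function.comp_def] using h

theorem degree_box_le [Fintype σ] {n : ℕ} (s : σ → Fin n) :
    (Finsupp.equivFunOnFinite.symm fun i => (s i : ℕ)).degree ≤ Fintype.card σ * n := by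
  rw [Finsupp.degree_eq_sum]
  refine (Finset.sum_le_card_nsmul _ _ n fun i _ => (s i).2.le).trans (by simp)

/-- A polynomial killing all generators kills the module, hence is zero by faithfulness. So `f ↦ (f
• g)_g` is injective and embeds the span of the box monomials into `G.card` copies of one filtration
step. -/
theorem pow_le_finrank_polyFiltration [Fintype σ] [IsScalarTower K (MvPolynomial σ K) M]
    [FaithfulSMul (MvPolynomial σ K) M] {G : Finset M}
    (hG : span (MvPolynomial σ K) (G : Set M) = ⊤) (n : ℕ) :
    n ^ Fintype.card σ ≤
      G.card * Module.finrank K (polyFiltration K σ G (Fintype.card σ * n)) := by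
  set W := polyFiltration K σ G (Fintype.card σ * n)
  let v : (σ → Fin n) → G → W := fun s g =>
    ⟨monomial (Finsupp.equivFunOnFinite.symm fun i => (s i : ℕ)) (1 : K) • (g : M),
      smul_mem_polyFiltration ((totalDegree_monomial_le _ _).trans (degree_box_le s)) g.2⟩
  let Λ : MvPolynomial σ K →ₗ[K] (G → M) :=
    LinearMap.pi fun g => (LinearMap.toSpanSingleton (MvPolynomial σ K) M (g : M)).restrictScalars K
  have hΛ : LinearMap.ker Λ = ⊥ := by
    rw [LinearMap.ker_eq_bot']
    intro f hf
    apply FaithfulSMul.eq_of_smul_eq_smul (α := M)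
    intro m
    have hm : m ∈ span (MvPolynomial σ K) (G : Set M) := hG ▸ mem_top
    rw [zero_smul]
    induction hm using span_induction with
    | mem x hx => exact congrFun hf ⟨x, hx⟩
    | zero => simp
    | add x y _ _ hx hy => rw [smul_add, hx, hy, add_zero]
    | smul a x _ hx => rw [smul_comm, hx, smul_zero]
  have hv : LinearIndependent K v := by
    refine LinearIndependent.of_comp (W.subtype.compLeft G) ?_
    exact (linearIndependent_boxMonomials K σ n).map' Λ hΛ
  classical
  have h := hv.fintype_card_le_finrank
  simpa [Module.finrank_pi_fintype] using h

/-- Since the two actions commute, how far a variable of the first ring shifts the second filtration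
can be read off on the finite set `G'`, so the shift is uniformly bounded and degree `n` costs
linearly in `n`. -/
theorem exists_polyFiltration_le [Finite σ] [IsScalarTower K (MvPolynomial σ K) M]
    [Module (MvPolynomial τ K) M] [IsScalarTower K (MvPolynomial τ K) M]
    [SMulCommClass (MvPolynomial σ K) (MvPolynomial τ K) M] (G : Finset M) {G' : Finset M}
    (hG' : span (MvPolynomial τ K) (G' : Set M) = ⊤) :
    ∃ c, ∀ n, polyFiltration K σ G n ≤ polyFiltration K τ G' (c * (n + 1)) := by
  have := IsScalarTower.to_smulCommClass (R := K) (A := MvPolynomial σ K) (M := M)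
  have hmono := polyFiltration_mono (K := K) (σ := τ) G'
  obtain ⟨a, ha⟩ := exists_forall_mem_of_finite hmono (fun g : G => (g : M))
    fun g => exists_mem_polyFiltration hG' _
  obtain ⟨b, hb⟩ := exists_forall_mem_of_finite hmono
    (fun x : σ × G' => (X x.1 : MvPolynomial σ K) • (x.2 : M))
    fun g => exists_mem_polyFiltration hG' _
  have hX : ∀ (i : σ) k m, m ∈ polyFiltration K τ G' k →
      (X i : MvPolynomial σ K) • m ∈ polyFiltration K τ G' (k + b) := by
    intro i k m hm
    induction hm using span_induction with
    | mem x hx =>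
      obtain ⟨f', hf', g, hg, rfl⟩ := hx
      rw [smul_comm, add_comm]
      exact smul_mem_polyFiltration_add hf' (hb (i, ⟨g, hg⟩))
    | zero => simp
    | add x y _ _ hx hy => rw [smul_add]; exact add_mem hx hy
    | smul a x _ hx => rw [smul_comm]; exact Submodule.smul_mem _ _ hx
  refine ⟨a + b, fun n => span_le.2 ?_⟩
  rintro _ ⟨f, hf, g, hg, rfl⟩
  exact hmono (by nlinarith) (smul_mem_of_totalDegree_le hmono hX hf (ha ⟨g, hg⟩))

theorem moduleFinite_compHom {R S : Type*} [CommRing R] [CommRing S] [Module R M]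
    [Module.Finite R M] (φ : S →+* R) (hφ : φ.Finite) :
    @Module.Finite S M _ _ (Module.compHom M φ) := by
  let _ : Algebra S R := φ.toAlgebra
  let _ : Module S M := Module.compHom M φ
  have : IsScalarTower S R M := ⟨fun f r m => mul_smul (φ f) r m⟩
  have : Module.Finite S R := hφ
  exact Module.Finite.trans R M

/-- Noether normalization applied to the polynomial ring modulo the annihilator of `M`. Over the
resulting polynomial ring `M` is both finite and faithful, which gives matching upper and lower
bounds, and the two degree filtrations are comparable. -/
theorem exists_hasPolynomialGrowth_polyFiltration [Finite σ]
    [IsScalarTower K (MvPolynomial σ K) M] {G : Finset M}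
    (hG : span (MvPolynomial σ K) (G : Set M) = ⊤) :
    ∃ d, HasPolynomialGrowth (fun n => Module.finrank K (polyFiltration K σ G n)) d := by
  rcases subsingleton_or_nontrivial M with hM | hM
  · exact ⟨0, 0, fun n => by simp [Module.finrank_zero_of_subsingleton], Or.inl rfl⟩
  let R := MvPolynomial σ K ⧸ Module.annihilator (MvPolynomial σ K) M
  let _ : Module R M := Module.quotientAnnihilator
  have hsmul : ∀ (f : MvPolynomial σ K) (m : M),
    (Ideal.Quotient.mk (Module.annihilator (MvPolynomial σ K) M) f : R) • m = f • m :=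
    fun f m => rfl
  have : IsScalarTower (MvPolynomial σ K) R M := ⟨fun f r m => by
    obtain ⟨r, rfl⟩ := Ideal.Quotient.mk_surjective r
    exact (hsmul (f * r) m).trans (mul_smul _ _ _)⟩
  have : IsScalarTower K R M := ⟨fun f r m => by
    obtain ⟨r, rfl⟩ := Ideal.Quotient.mk_surjective r
    exact (hsmul (f • r) m).trans (smul_assoc _ _ _)⟩
  -- Normalization requires a nonzero ring, which is why the zero module was treated separately.
  have : Nontrivial R := Ideal.Quotient.nontrivial_iff.2 fun h => by
    obtain ⟨m, hm⟩ := exists_ne (0 : M)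
    have h1 : (1 : MvPolynomial σ K) ∈ Module.annihilator (MvPolynomial σ K) M := h ▸ mem_top
    exact hm (by simpa using Module.mem_annihilator.1 h1 m)
  obtain ⟨d, φ, hφ, hfin⟩ := exists_finite_inj_algHom_of_fg K R
  let _ : Module (MvPolynomial (Fin d) K) M := Module.compHom M φ.toRingHom
  have hsmul' : ∀ (f : MvPolynomial (Fin d) K) (m : M), f • m = φ f • m := fun f m => rfl
  have : IsScalarTower K (MvPolynomial (Fin d) K) M := ⟨fun k f m => by
    rw [hsmul', hsmul', map_smul, smul_assoc]⟩
  -- Two polynomials acting equally have images under `φ` that differ by an annihilating element, so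
  -- these images coincide in `R`, and `φ` is injective.
  have : FaithfulSMul (MvPolynomial (Fin d) K) M := ⟨fun {f g} h => hφ <| by
    obtain ⟨a, ha⟩ := Ideal.Quotient.mk_surjective (φ f)
    obtain ⟨b, hb⟩ := Ideal.Quotient.mk_surjective (φ g)
    rw [← ha, ← hb, Ideal.Quotient.eq, Module.mem_annihilator]
    intro m
    have := h m
    rwa [hsmul', hsmul', ← ha, ← hb, hsmul, hsmul, ← sub_eq_zero, ← sub_smul] at this⟩
  have : SMulCommClass (MvPolynomial σ K) (MvPolynomial (Fin d) K) M := ⟨fun f g m => by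
    rw [hsmul', hsmul', ← hsmul, ← hsmul, smul_comm]⟩
  have : SMulCommClass (MvPolynomial (Fin d) K) (MvPolynomial σ K) M := SMulCommClass.symm _ _ _
  have : Module.Finite (MvPolynomial σ K) M := ⟨G, hG⟩
  have : Module.Finite R M := Module.Finite.of_restrictScalars_finite (MvPolynomial σ K) R M
  have : Module.Finite (MvPolynomial (Fin d) K) M := moduleFinite_compHom φ.toRingHom hfin
  obtain ⟨G', hG'⟩ := Module.Finite.fg_top (R := MvPolynomial (Fin d) K) (M := M)
  obtain ⟨c, hc⟩ := exists_polyFiltration_le (K := K) (σ := σ) G hG'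
  obtain ⟨c', hc'⟩ := exists_polyFiltration_le (K := K) (σ := Fin d) G' hG
  refine ⟨d, HasPolynomialGrowth.of_comparable
    (g₂ := fun n => Module.finrank K (polyFiltration K (Fin d) G' n)) (a := 0) (c := c + c')
    ⟨G'.card + d, fun n => ?_, Or.inr fun n => ?_⟩ ?_ (fun n => ?_) fun n => ?_⟩
  · refine (finrank_polyFiltration_le G' n).trans ?_
    rw [Fintype.card_fin]
    gcongr
    omega
  · have h := pow_le_finrank_polyFiltration (K := K) hG' n
    rw [Fintype.card_fin] at h
    refine h.trans (Nat.mul_le_mul (by omega) (finrank_mono (polyFiltration_mono G' ?_)))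
    nlinarith
  · exact fun m n h => finrank_mono (polyFiltration_mono G h)
  · rw [zero_add]
    exact finrank_mono ((hc n).trans (polyFiltration_mono G' (by gcongr; omega)))
  · exact finrank_mono ((hc' n).trans (polyFiltration_mono G (by gcongr; omega)))

end FilteredModules

/-! ### Spans of words and independence of the generating system -/

section WordSpans

open Submodule

variable (K : Type u) [Field K] {A : Type v} [NonUnitalNonAssocRing A] [Module K A]
  {ι : Type*}

/-- The span of the nonassociative words of length at most `n` in the elements `t i`. -/
def wordSpan (t : ι → A) (n : ℕ) : Submodule K A :=
  span K {x | ∃ w : FreeMagma ι, w.length ≤ n ∧ FreeMagma.lift t w = x}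

theorem wordSpan_mono (t : ι → A) : Monotone (wordSpan K t) :=
  fun _ _ h => span_mono fun _ ⟨w, hw, hx⟩ => ⟨w, hw.trans h, hx⟩

variable {K} in
theorem lift_mem_wordSpan {t : ι → A} {w : FreeMagma ι} {n : ℕ} (hw : w.length ≤ n) :
    FreeMagma.lift t w ∈ wordSpan K t n :=
  subset_span ⟨w, hw, rfl⟩

theorem freeMagma_length_mul (x y : FreeMagma ι) : (x * y).length = x.length + y.length := rfl

theorem finite_length_le_freeMagma (ι : Type*) [Finite ι] (n : ℕ) :
    {w : FreeMagma ι | w.length ≤ n}.Finite := by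
  induction n with
  | zero =>
    refine Set.finite_empty.subset fun w hw => ?_
    have := w.length_pos
    simp only [Set.mem_ofPred_eq] at hw
    omega
  | succ n ih =>
    refine ((Set.finite_range FreeMagma.of).union
      (Set.Finite.image2 (fun x y => x * y) ih ih)).subset fun w hw => ?_
    cases w with
    | of i => exact Or.inl ⟨i, rfl⟩
    | mul x y =>
      have hx := x.length_pos
      have hy := y.length_pos
      change x.length + y.length ≤ n + 1 at hw
      exact Or.inr ⟨x, (by simp; omega), y, (by simp; omega), rfl⟩

instance finiteDimensional_wordSpan [Finite ι] (t : ι → A) (n : ℕ) :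
    FiniteDimensional K (wordSpan K t n) :=
  FiniteDimensional.span_of_finite K ((finite_length_le_freeMagma ι n).image (FreeMagma.lift t))

theorem subsingleton_identityElements : (identityElements A).Subsingleton :=
  fun e he f hf => ((hf e).2.symm.trans (he f).1)

instance finiteDimensional_span_identityElements :
    FiniteDimensional K (span K (identityElements A)) :=
  FiniteDimensional.span_of_finite K subsingleton_identityElements.finite

theorem finrank_span_identityElements_le : Module.finrank K (span K (identityElements A)) ≤ 1 := by
  rcases (subsingleton_identityElements (A := A)).eq_empty_or_singleton with h | ⟨e, h⟩
  · rw [h, span_empty, finrank_bot]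
    exact zero_le_one
  · rw [h]
    exact (finrank_span_le_card ({e} : Set A)).trans (by simp)

/-- The sum `V ^ 0 + ⋯ + V ^ n`, where `V` is the span of `S`. -/
noncomputable def growthSpan (S : Finset A) (n : ℕ) : Submodule K A :=
  ⨆ k ∈ Finset.range (n + 1), submodulePower K (span K (S : Set A)) k

theorem growthFunction_eq_finrank (S : Finset A) (n : ℕ) :
    growthFunction K S n = Module.finrank K (growthSpan K S n) := rfl

theorem growthSpan_mono (S : Finset A) : Monotone (growthSpan K S) :=
  fun _ _ h => biSup_mono fun _ hk => Finset.range_mono (by omega) hk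

variable {K}

theorem mem_submodulePower_of_lift {t : ι → A} {V : Submodule K A} (h : ∀ i, t i ∈ V)
    (w : FreeMagma ι) : FreeMagma.lift t w ∈ submodulePower K V w.length := by
  obtain ⟨k, hk⟩ := Nat.exists_eq_succ_of_ne_zero w.length_pos.ne'
  rw [hk]
  refine subset_span ⟨FreeMagma.map (fun i => (⟨t i, h i⟩ : V)) w, ?_, ?_⟩
  · rw [← Nat.succ_eq_add_one, ← hk]
    clear hk
    induction w with
    | ih1 i => rfl
    | ih2 x y hx hy => rw [map_mul, freeMagma_length_mul, freeMagma_length_mul, hx, hy]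
  · clear hk
    induction w with
    | ih1 i => rfl
    | ih2 x y hx hy => rw [map_mul, map_mul, map_mul, hx, hy]

variable [IsScalarTower K A A] [SMulCommClass K A A]

theorem mul_mem_of_forall_mem_span {s t : Set A} {N : Submodule K A}
    (h : ∀ x ∈ s, ∀ y ∈ t, x * y ∈ N) {a b : A} (ha : a ∈ span K s) (hb : b ∈ span K t) :
    a * b ∈ N := by
  have h1 : map₂ (LinearMap.mul K A) (span K s) (span K t) ≤ N := by
    rw [map₂_span_span, span_le]
    rintro _ ⟨x, hx, y, hy, rfl⟩
    exact h x hx y hy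
  exact h1 (apply_mem_map₂ (LinearMap.mul K A) ha hb)

theorem mul_mem_wordSpan {t : ι → A} {m n : ℕ} {a b : A} (ha : a ∈ wordSpan K t m)
    (hb : b ∈ wordSpan K t n) : a * b ∈ wordSpan K t (m + n) := by
  refine mul_mem_of_forall_mem_span ?_ ha hb
  rintro _ ⟨w, hw, rfl⟩ _ ⟨w', hw', rfl⟩
  rw [← map_mul]
  exact lift_mem_wordSpan (Nat.add_le_add hw hw')

/-- By bilinearity, words in elements of the span expand into words in the spanning family `t`, with
no increase in length. -/
theorem growthSpan_eq {t : ι → A} {S : Finset A} (h : Set.range t = S) (n : ℕ) :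
    growthSpan K S n = span K (identityElements A) ⊔ wordSpan K t n := by
  apply le_antisymm
  · refine iSup₂_le fun k hk => ?_
    rcases k with _ | k
    · exact le_sup_left
    refine le_trans (span_le.2 ?_) le_sup_right
    rintro _ ⟨w, hw, rfl⟩
    refine wordSpan_mono K t (show w.length ≤ n by rw [hw]; simpa using hk) ?_
    clear hw hk
    induction w with
    | ih1 x =>
      refine span_mono ?_ x.2
      intro y hy
      obtain ⟨i, rfl⟩ := h.symm.subset hy
      exact ⟨FreeMagma.of i, le_rfl, rfl⟩
    | ih2 x y hx hy =>
      rw [map_mul]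
      exact mul_mem_wordSpan hx hy
  · refine sup_le ?_ (span_le.2 ?_)
    · exact le_biSup (submodulePower K (span K (S : Set A))) (i := 0) (by simp)
    · rintro _ ⟨w, hw, rfl⟩
      exact le_biSup (submodulePower K (span K (S : Set A))) (i := w.length)
        (Finset.mem_coe.2 (Finset.mem_range.2 (by omega)))
        (mem_submodulePower_of_lift (fun i => subset_span (h ▸ ⟨i, rfl⟩)) w)

theorem growthSpan_eq_val (S : Finset A) (n : ℕ) :
    growthSpan K S n = span K (identityElements A) ⊔ wordSpan K ((↑) : S → A) n :=
  growthSpan_eq (by simp) n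

instance finiteDimensional_growthSpan (S : Finset A) (n : ℕ) :
    FiniteDimensional K (growthSpan K S n) := by
  rw [growthSpan_eq_val]
  infer_instance

theorem growthFunction_mono (S : Finset A) : Monotone (growthFunction K S) :=
  fun m n h => finrank_mono (s := growthSpan K S m) (t := growthSpan K S n) (growthSpan_mono K S h)

theorem identity_mem_growthSpan {S : Finset A} {e : A} (he : e ∈ identityElements A) (n : ℕ) :
    e ∈ growthSpan K S n := by
  rw [growthSpan_eq_val]
  exact mem_sup_left (subset_span he)

/-- An identity element disappears from any product, so including `V ^ 0` does not spoil the
additivity of lengths. -/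
theorem mul_mem_growthSpan {S : Finset A} {m n : ℕ} {a b : A} (ha : a ∈ growthSpan K S m)
    (hb : b ∈ growthSpan K S n) : a * b ∈ growthSpan K S (m + n) := by
  have hmono := growthSpan_mono K S
  have hb' := hmono (Nat.le_add_left n m) hb
  have ha' := hmono (Nat.le_add_right m n) ha
  rw [growthSpan_eq_val, wordSpan, ← span_union] at ha hb
  refine mul_mem_of_forall_mem_span ?_ ha hb
  rintro x hx y hy
  have hmem : ∀ (k : ℕ) (w : FreeMagma S), w.length ≤ k →
      FreeMagma.lift ((↑) : S → A) w ∈ growthSpan K S k := fun k w hw => by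
    rw [growthSpan_eq_val]
    exact mem_sup_right (lift_mem_wordSpan hw)
  rcases hx with hx | ⟨w, hw, rfl⟩
  · rw [(hx y).1]
    rcases hy with hy | ⟨w, hw, rfl⟩
    · exact identity_mem_growthSpan hy _
    · exact hmem _ _ (by omega)
  · rcases hy with hy | ⟨w', hw', rfl⟩
    · rw [(hy _).2]
      exact hmem _ _ (by omega)
    · rw [← map_mul]
      exact hmem _ _ (Nat.add_le_add hw hw')

theorem IsGeneratingSystem.exists_mem_growthSpan {S : Finset A} (hS : IsGeneratingSystem K S)
    (a : A) : ∃ n, a ∈ growthSpan K S n := by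
  have hmono := growthSpan_mono K S
  have ha : a ∈ NonUnitalAlgebra.adjoin K ((S : Set A) ∪ identityElements A) := by
    rw [show NonUnitalAlgebra.adjoin K ((S : Set A) ∪ identityElements A) = ⊤ from hS]
    trivial
  induction ha using NonUnitalAlgebra.adjoin_induction with
  | mem x hx =>
    rcases hx with hx | hx
    · refine ⟨1, ?_⟩
      rw [growthSpan_eq_val]
      exact mem_sup_right (lift_mem_wordSpan (t := ((↑) : S → A)) (w := FreeMagma.of ⟨x, hx⟩) le_rfl)
    · exact ⟨0, identity_mem_growthSpan hx 0⟩
  | zero => exact ⟨0, zero_mem _⟩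
  | add x y _ _ hx hy =>
    obtain ⟨a, ha⟩ := hx
    obtain ⟨b, hb⟩ := hy
    exact ⟨max a b, add_mem (hmono (le_max_left _ _) ha) (hmono (le_max_right _ _) hb)⟩
  | mul x y _ _ hx hy =>
    obtain ⟨a, ha⟩ := hx
    obtain ⟨b, hb⟩ := hy
    exact ⟨a + b, mul_mem_growthSpan ha hb⟩
  | smul r x _ hx =>
    obtain ⟨a, ha⟩ := hx
    exact ⟨a, Submodule.smul_mem _ _ ha⟩

/-- If each element of `T` is reached by length `c` in `S`, then a word of length `n` in `T` is
reached by length `c * n`. -/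
theorem IsGeneratingSystem.exists_growthSpan_le {S : Finset A} (hS : IsGeneratingSystem K S)
    (T : Finset A) : ∃ c, ∀ n, growthSpan K T n ≤ growthSpan K S (c * n) := by
  have hmono := growthSpan_mono K S
  obtain ⟨c, hc⟩ := exists_forall_mem_of_finite hmono (fun x : T => (x : A))
    fun x => hS.exists_mem_growthSpan _
  refine ⟨c, fun n => ?_⟩
  rw [growthSpan_eq_val T]
  refine sup_le (span_le.2 fun e he => identity_mem_growthSpan he _) (span_le.2 ?_)
  rintro _ ⟨w, hw, rfl⟩
  refine hmono (Nat.mul_le_mul_left c hw) ?_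
  clear hw
  induction w with
  | ih1 x => simpa using hc x
  | ih2 x y hx hy =>
    rw [map_mul, freeMagma_length_mul, mul_add]
    exact mul_mem_growthSpan hx hy

theorem hasGKDim_of_hasPolynomialGrowth {S : Finset A} (hS : IsGeneratingSystem K S) {d : ℕ}
    (h : HasPolynomialGrowth (growthFunction K S) d) : HasGKDim K A (d : EReal) := by
  refine ⟨⟨S, hS⟩, fun T hT => HasPolynomialGrowth.limsup_logb (g := growthFunction K T) ?_⟩
  obtain ⟨a, ha⟩ := hS.exists_growthSpan_le T
  obtain ⟨b, hb⟩ := hT.exists_growthSpan_le S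
  refine h.of_comparable (growthFunction_mono T) (a := 0) (c := a + b) (fun n => ?_) fun n => ?_
  · rw [zero_add]
    exact finrank_mono (t := growthSpan K S _) ((ha n).trans (growthSpan_mono K S (by nlinarith)))
  · exact finrank_mono (t := growthSpan K T _) ((hb n).trans (growthSpan_mono K T (by nlinarith)))

theorem isGeneratingSystem_of_span_eq_top {t : ι → A} {S : Finset A} (h : Set.range t = S)
    (ht : span K (Set.range (FreeMagma.lift t)) = ⊤) : IsGeneratingSystem K S := by
  rw [IsGeneratingSystem, eq_top_iff]
  intro a _
  have ha : a ∈ span K (Set.range (FreeMagma.lift t)) := ht ▸ mem_top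
  have hle : span K (Set.range (FreeMagma.lift t)) ≤
      (NonUnitalAlgebra.adjoin K ((S : Set A) ∪ identityElements A)).toSubmodule := by
    rw [span_le]
    rintro _ ⟨w, rfl⟩
    induction w with
    | ih1 i => exact NonUnitalAlgebra.subset_adjoin K (Or.inl (h ▸ ⟨i, rfl⟩))
    | ih2 x y hx hy =>
      rw [map_mul]
      exact mul_mem (S := NonUnitalSubalgebra K A) hx hy
  exact hle ha

end WordSpans

/-! ### Normal monomials and the commutation of left and right multiplications -/

section NormalMonomials

open Submodule

/-- The sign `(-1) ^ (a b)` attached to a pair of parities. -/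
def superSign (K : Type u) [Field K] (a b : ZMod 2) : K := (-1) ^ (a.val * b.val)

theorem superSign_add_right (K : Type u) [Field K] (a b c : ZMod 2) :
    superSign K a (b + c) = superSign K a b * superSign K a c := by
  rw [superSign, superSign, superSign, ← pow_add, ← Nat.mul_add, ZMod.val_add,
    ← neg_one_pow_congr (n := a.val * (b.val + c.val))]
  rw [Nat.even_iff, Nat.even_iff, Nat.mul_mod a.val ((b.val + c.val) % 2), Nat.mod_mod, ← Nat.mul_mod]

theorem superSign_comm (K : Type u) [Field K] (a b : ZMod 2) :
    superSign K a b = superSign K b a := by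
  rw [superSign, superSign, mul_comm]

theorem superSign_add_left (K : Type u) [Field K] (a b c : ZMod 2) :
    superSign K (a + b) c = superSign K a c * superSign K b c := by
  rw [superSign_comm, superSign_add_right, superSign_comm K c, superSign_comm K c]

variable (K : Type u) [Field K] {A : Type v} [NonUnitalNonAssocRing A] [Module K A] {p q : ℕ}

/-- The elements `t (inl i)` and `t (inr j)` generate `A`, and their monomials satisfy the
identities of bicommutative superalgebras, if the elements of the second kind are considered odd. -/
structure IsBicommutativeSystem (t : Fin p ⊕ Fin q → A) : Prop where
  span_eq_top : span K (Set.range (FreeMagma.lift t)) = ⊤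
  left_comm : ∀ x y z : SuperMonomial p q, FreeMagma.lift t (x * (y * z)) =
    superSign K x.parity y.parity • FreeMagma.lift t (y * (x * z))
  right_comm : ∀ x y z : SuperMonomial p q, FreeMagma.lift t ((x * y) * z) =
    superSign K y.parity z.parity • FreeMagma.lift t ((x * z) * y)

/-- The monomials obtained from a product of two variables by multiplying by variables. -/
inductive IsNormalMonomial {ι : Type*} : FreeMagma ι → Prop
  | base (i j : ι) : IsNormalMonomial (FreeMagma.of i * FreeMagma.of j)
  | left (i : ι) (w : FreeMagma ι) : IsNormalMonomial w → IsNormalMonomial (FreeMagma.of i * w)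
  | right (i : ι) (w : FreeMagma ι) : IsNormalMonomial w → IsNormalMonomial (w * FreeMagma.of i)

/-- The value of `w` is a multiple of the value of a normal monomial of the same length. -/
def HasNormalForm {ι : Type*} (t : ι → A) (w : FreeMagma ι) : Prop :=
  ∃ (n : FreeMagma ι) (c : K), IsNormalMonomial n ∧ n.length = w.length ∧
    FreeMagma.lift t w = c • FreeMagma.lift t n

variable {K}

theorem IsNormalMonomial.hasNormalForm {ι : Type*} (t : ι → A) {w : FreeMagma ι}
    (h : IsNormalMonomial w) : HasNormalForm K t w := ⟨w, 1, h, rfl, (one_smul _ _).symm⟩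

theorem HasNormalForm.of_smul {ι : Type*} {t : ι → A} {w w' : FreeMagma ι} {c : K}
    (h : HasNormalForm K t w') (hl : w'.length = w.length)
    (hw : FreeMagma.lift t w = c • FreeMagma.lift t w') : HasNormalForm K t w := by
  obtain ⟨n, d, hn, hl', h'⟩ := h
  exact ⟨n, c * d, hn, hl'.trans hl, by rw [hw, h', smul_smul]⟩

variable [IsScalarTower K A A] [SMulCommClass K A A]

theorem HasNormalForm.mul_right {ι : Type*} {t : ι → A} {w v : FreeMagma ι}
    (h : HasNormalForm K t w) (hv : ∀ n, IsNormalMonomial n → HasNormalForm K t (n * v)) :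
    HasNormalForm K t (w * v) := by
  obtain ⟨n, d, hn, hl, h'⟩ := h
  refine (hv n hn).of_smul (c := d) ?_ ?_
  · rw [freeMagma_length_mul, freeMagma_length_mul, hl]
  · rw [map_mul, map_mul, h', smul_mul_assoc]

theorem HasNormalForm.mul_left {ι : Type*} {t : ι → A} {w v : FreeMagma ι}
    (h : HasNormalForm K t w) (hv : ∀ n, IsNormalMonomial n → HasNormalForm K t (v * n)) :
    HasNormalForm K t (v * w) := by
  obtain ⟨n, d, hn, hl, h'⟩ := h
  refine (hv n hn).of_smul (c := d) ?_ ?_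
  · rw [freeMagma_length_mul, freeMagma_length_mul, hl]
  · rw [map_mul, map_mul, h', mul_smul_comm]

namespace IsBicommutativeSystem

variable {t : Fin p ⊕ Fin q → A} (ht : IsBicommutativeSystem K t)

include ht

/-- Up to sign, `(x y) n = (x n) y` and `n (x y) = x (n y)`: multiplication by a product is
multiplication by its factors in turn. All claims are carried through one induction because each
reduction uses both sides; single variables are listed apart since they are not normal monomials. -/
theorem hasNormalForm_aux (w : SuperMonomial p q) :
    (∀ n, IsNormalMonomial n → HasNormalForm K t (w * n)) ∧
    (∀ n, IsNormalMonomial n → HasNormalForm K t (n * w)) ∧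
    (∀ i, HasNormalForm K t (w * FreeMagma.of i)) ∧
    (∀ i, HasNormalForm K t (FreeMagma.of i * w)) ∧
    ((∃ i, w = FreeMagma.of i) ∨ HasNormalForm K t w) := by
  induction w using FreeMagma.recOnMul with
  | ih1 i =>
    exact ⟨fun n hn => (hn.left i n).hasNormalForm t, fun n hn => (hn.right i n).hasNormalForm t,
      fun j => (IsNormalMonomial.base i j).hasNormalForm t,
      fun j => (IsNormalMonomial.base j i).hasNormalForm t, Or.inl ⟨i, rfl⟩⟩
  | ih2 x y hx hy =>
    obtain ⟨hx1, hx2, hx3, hx4, hx5⟩ := hx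
    obtain ⟨hy1, hy2, hy3, hy4, hy5⟩ := hy
    refine ⟨fun n hn => ?_, fun n hn => ?_, fun i => ?_, fun i => ?_, Or.inr ?_⟩
    · refine ((hx1 n hn).mul_right hy2).of_smul ?_ (ht.right_comm x y n)
      simp only [freeMagma_length_mul]; omega
    · refine ((hy2 n hn).mul_left hx1).of_smul ?_ (ht.left_comm n x y)
      simp only [freeMagma_length_mul]; omega
    · refine ((hx3 i).mul_right hy2).of_smul ?_ (ht.right_comm x y _)
      simp only [freeMagma_length_mul]; omega
    · refine ((hy4 i).mul_left hx1).of_smul ?_ (ht.left_comm _ x y)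
      simp only [freeMagma_length_mul]; omega
    · rcases hx5 with ⟨i, rfl⟩ | hx5
      · exact hy4 i
      · exact hx5.mul_right hy2

theorem hasNormalForm_mul (x y : SuperMonomial p q) : HasNormalForm K t (x * y) := by
  rcases (ht.hasNormalForm_aux (x * y)).2.2.2.2 with ⟨i, h⟩ | h
  · cases h
  · exact h

/-- The sign involves only the first two factors, so linearity allows the third to be an arbitrary,
possibly inhomogeneous, element. The same holds on the right. -/
theorem lift_mul_lift_mul (x y : SuperMonomial p q) (a : A) :
    FreeMagma.lift t x * (FreeMagma.lift t y * a) =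
      superSign K x.parity y.parity • (FreeMagma.lift t y * (FreeMagma.lift t x * a)) := by
  have ha : a ∈ span K (Set.range (FreeMagma.lift t)) := ht.span_eq_top ▸ mem_top
  induction ha using span_induction with
  | mem a ha =>
    obtain ⟨z, rfl⟩ := ha
    simpa only [map_mul] using ht.left_comm x y z
  | zero => simp
  | add a b _ _ ha hb => simp only [mul_add, ha, hb, smul_add]
  | smul c a _ ha => simp only [mul_smul_comm, ha]; rw [smul_comm]

theorem mul_lift_mul_lift (a : A) (y z : SuperMonomial p q) :
    (a * FreeMagma.lift t y) * FreeMagma.lift t z =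
      superSign K y.parity z.parity • ((a * FreeMagma.lift t z) * FreeMagma.lift t y) := by
  have ha : a ∈ span K (Set.range (FreeMagma.lift t)) := ht.span_eq_top ▸ mem_top
  induction ha using span_induction with
  | mem a ha =>
    obtain ⟨x, rfl⟩ := ha
    simpa only [map_mul] using ht.right_comm x y z
  | zero => simp
  | add a b _ _ ha hb => simp only [add_mul, ha, hb, smul_add]
  | smul c a _ ha => simp only [smul_mul_assoc, ha]; rw [smul_comm]

/-- For monomials `a = z`, `b = w`, both sides are signed copies of `(z y) (x w)`, and both signs
equal `(-1)` to the power `|x||y| + |x||z| + |w||y|`. Having a product in the middle is what makes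
these rearrangements possible, hence the restriction to `A ^ 2` later. -/
theorem lift_mul_mul_lift (x y : SuperMonomial p q) (a b : A) :
    FreeMagma.lift t x * ((a * b) * FreeMagma.lift t y) =
      (FreeMagma.lift t x * (a * b)) * FreeMagma.lift t y := by
  have ha : a ∈ span K (Set.range (FreeMagma.lift t)) := ht.span_eq_top ▸ mem_top
  have hb : b ∈ span K (Set.range (FreeMagma.lift t)) := ht.span_eq_top ▸ mem_top
  induction ha using span_induction with
  | mem a ha =>
    induction hb using span_induction with
    | mem b hb =>
      obtain ⟨z, rfl⟩ := ha
      obtain ⟨w, rfl⟩ := hb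
      have hp : ∀ u v : SuperMonomial p q, SuperMonomial.parity (u * v) =
        SuperMonomial.parity u + SuperMonomial.parity v := fun _ _ => rfl
      have h1 := ht.mul_lift_mul_lift (FreeMagma.lift t z) w y
      have h2 := ht.lift_mul_lift_mul x (z * y) (FreeMagma.lift t w)
      have h3 := ht.lift_mul_lift_mul x z (FreeMagma.lift t w)
      have h4 := ht.mul_lift_mul_lift (FreeMagma.lift t z) (x * w) y
      rw [map_mul] at h2 h4
      rw [h1, mul_smul_comm, h2, h3, smul_mul_assoc, h4, smul_smul, smul_smul, hp, hp,
        superSign_add_right, superSign_add_left]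
      congr 1
      ring
    | zero => simp
    | add b c _ _ hb hc => simp only [add_mul, mul_add, hb, hc]
    | smul c b _ hb => simp only [mul_smul_comm, smul_mul_assoc, hb]
  | zero => simp
  | add a c _ _ ha hc => simp only [add_mul, mul_add, ha, hc]
  | smul c a _ ha => simp only [mul_smul_comm, smul_mul_assoc, ha]

end IsBicommutativeSystem

end NormalMonomials

/-! ### Polynomial actions from commuting operators, finiteness for anticommuting ones -/

section CommutingOperators

open MvPolynomial Submodule
open scoped IsMulCommutative

variable {K : Type u} [Field K] {σ : Type*} {M : Type v} [AddCommGroup M] [Module K M]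

/-- The subalgebra generated by commuting operators is commutative, so polynomials can be evaluated
in it although the full endomorphism ring is not commutative. -/
theorem exists_algHom_of_commute (e : σ → Module.End K M) (he : ∀ i j, e i * e j = e j * e i) :
    ∃ φ : MvPolynomial σ K →ₐ[K] Module.End K M, ∀ i, φ (X i) = e i := by
  have hcomm : ∀ a ∈ Set.range e, ∀ b ∈ Set.range e, a * b = b * a := by
    rintro _ ⟨i, rfl⟩ _ ⟨j, rfl⟩
    exact he i j
  have := Algebra.isMulCommutative_adjoin K hcomm
  let f : MvPolynomial σ K →ₐ[K] Algebra.adjoin K (Set.range e) :=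
    aeval fun i => ⟨e i, Algebra.subset_adjoin ⟨i, rfl⟩⟩
  refine ⟨(Algebra.adjoin K (Set.range e)).val.comp f, fun i => ?_⟩
  exact congrArg Subtype.val (aeval_X (R := K)
    (fun i => (⟨e i, Algebra.subset_adjoin ⟨i, rfl⟩⟩ : Algebra.adjoin K (Set.range e))) i)

theorem exists_module_of_commute (e : σ → Module.End K M) (he : ∀ i j, e i * e j = e j * e i) :
    ∃ (_ : Module (MvPolynomial σ K) M), IsScalarTower K (MvPolynomial σ K) M ∧
      ∀ i m, (X i : MvPolynomial σ K) • m = e i m := by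
  obtain ⟨φ, hφ⟩ := exists_algHom_of_commute e he
  let _ : Module (MvPolynomial σ K) M := Module.compHom M φ.toRingHom
  have hsmul : ∀ (f : MvPolynomial σ K) (m : M), f • m = φ f m := fun f m => rfl
  refine ⟨inferInstance, ⟨fun k f m => ?_⟩, fun i m => ?_⟩
  · rw [hsmul, map_smul, hsmul, LinearMap.smul_apply]
  · rw [hsmul, hφ]

theorem map_smul_of_forall_X [Module (MvPolynomial σ K) M] [IsScalarTower K (MvPolynomial σ K) M]
    (T : Module.End K M) (hT : ∀ i m, T ((X i : MvPolynomial σ K) • m) = (X i : MvPolynomial σ K) • T m)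
    (f : MvPolynomial σ K) (m : M) : T (f • m) = f • T m := by
  induction f using MvPolynomial.induction_on generalizing m with
  | C a => rw [← algebraMap_eq, algebraMap_smul, algebraMap_smul, map_smul]
  | add f g hf hg => rw [add_smul, map_add, hf, hg, add_smul]
  | mul_X f i hf => rw [mul_smul, hf, hT, mul_smul]

/-- Anticommutation moves a repeated factor next to its copy at the cost of signs, and the square
vanishes. -/
theorem list_prod_eq_zero_of_not_nodup {R ι : Type*} [Ring R] (o : ι → R)
    (hanti : ∀ i j, o i * o j = -(o j * o i)) (hsq : ∀ i, o i * o i = 0) {l : List ι}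
    (hl : ¬ l.Nodup) : (l.map o).prod = 0 := by
  have key : ∀ (i : ι) (l : List ι), i ∈ l → o i * (l.map o).prod = 0 := by
    intro i l hi
    induction l with
    | nil => simp at hi
    | cons j l ih =>
      rw [List.map_cons, List.prod_cons, ← mul_assoc]
      rcases List.mem_cons.1 hi with rfl | hi
      · rw [hsq, zero_mul]
      · rw [hanti, neg_mul, mul_assoc, ih hi, mul_zero, neg_zero]
  induction l with
  | nil => simp at hl
  | cons i l ih =>
    rw [List.map_cons, List.prod_cons]
    by_cases hi : i ∈ l
    · exact key i l hi
    · rw [ih fun h => hl (List.nodup_cons.2 ⟨hi, h⟩), mul_zero]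

theorem finite_range_list_prod {R ι : Type*} [Ring R] [Finite ι] (o : ι → R)
    (hanti : ∀ i j, o i * o j = -(o j * o i)) (hsq : ∀ i, o i * o i = 0) :
    (Set.range fun l : List ι => (l.map o).prod).Finite := by
  have := Fintype.ofFinite ι
  refine (((List.finite_length_le ι (Fintype.card ι)).image fun l => (l.map o).prod).union
    (Set.finite_singleton 0)).subset ?_
  rintro _ ⟨l, rfl⟩
  by_cases hl : l.Nodup
  · exact Or.inl ⟨l, hl.length_le_card, rfl⟩
  · exact Or.inr (list_prod_eq_zero_of_not_nodup o hanti hsq hl)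

end CommutingOperators

/-! ### Multiplication operators on the square of the algebra -/

section SquareOperators

open MvPolynomial Submodule

variable (K : Type u) [Field K] (A : Type v) [NonUnitalNonAssocRing A] [Module K A]

/-- The square `A ^ 2` of the algebra `A`. -/
def algebraSquare : Submodule K A := span K {c | ∃ a b : A, a * b = c}

variable {K A}

theorem mul_mem_algebraSquare (a b : A) : a * b ∈ algebraSquare K A := subset_span ⟨a, b, rfl⟩

variable (K) [IsScalarTower K A A] [SMulCommClass K A A]

/-- Left multiplication by `a` on `A ^ 2`. -/
def squareMulLeft (a : A) : Module.End K (algebraSquare K A) :=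
  (LinearMap.mulLeft K a).restrict fun m _ => mul_mem_algebraSquare a m

/-- Right multiplication by `a` on `A ^ 2`. -/
def squareMulRight (a : A) : Module.End K (algebraSquare K A) :=
  (LinearMap.mulRight K a).restrict fun m _ => mul_mem_algebraSquare m a

variable {K}

@[simp] theorem coe_squareMulLeft (a : A) (m : algebraSquare K A) :
    (squareMulLeft K a m : A) = a * m := rfl

@[simp] theorem coe_squareMulRight (a : A) (m : algebraSquare K A) :
    (squareMulRight K a m : A) = m * a := rfl

namespace IsBicommutativeSystem

variable {p q : ℕ} {t : Fin p ⊕ Fin q → A} (ht : IsBicommutativeSystem K t)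

include ht

theorem squareMulLeft_mul (i j : Fin p ⊕ Fin q) :
    squareMulLeft K (t i) * squareMulLeft K (t j) =
      superSign K (SuperMonomial.parity (FreeMagma.of i)) (SuperMonomial.parity (FreeMagma.of j)) •
        (squareMulLeft K (t j) * squareMulLeft K (t i)) :=
  LinearMap.ext fun m => Subtype.ext (ht.lift_mul_lift_mul (FreeMagma.of i) (FreeMagma.of j) m)

theorem squareMulRight_mul (i j : Fin p ⊕ Fin q) :
    squareMulRight K (t i) * squareMulRight K (t j) =
      superSign K (SuperMonomial.parity (FreeMagma.of j)) (SuperMonomial.parity (FreeMagma.of i)) •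
        (squareMulRight K (t j) * squareMulRight K (t i)) :=
  LinearMap.ext fun m => Subtype.ext (ht.mul_lift_mul_lift m (FreeMagma.of j) (FreeMagma.of i))

theorem commute_squareMulLeft_squareMulRight (i j : Fin p ⊕ Fin q) :
    Commute (squareMulLeft K (t i)) (squareMulRight K (t j)) := by
  refine LinearMap.ext fun ⟨m, hm⟩ => Subtype.ext ?_
  change t i * (m * t j) = (t i * m) * t j
  induction hm using span_induction with
  | mem m hm =>
    obtain ⟨a, b, rfl⟩ := hm
    exact ht.lift_mul_mul_lift (FreeMagma.of i) (FreeMagma.of j) a b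
  | zero => simp
  | add m n _ _ hm hn => simp only [add_mul, mul_add, hm, hn]
  | smul c m _ hm => simp only [smul_mul_assoc, mul_smul_comm, hm]

omit ht in
theorem superSign_inl (i : Fin p) (x : ZMod 2) :
    superSign K (SuperMonomial.parity (FreeMagma.of (Sum.inl i : Fin p ⊕ Fin q))) x = 1 := by
  simp [SuperMonomial.parity, superSign]

omit ht in
theorem superSign_inr (i j : Fin q) :
    superSign K (SuperMonomial.parity (FreeMagma.of (Sum.inr i : Fin p ⊕ Fin q)))
      (SuperMonomial.parity (FreeMagma.of (Sum.inr j : Fin p ⊕ Fin q))) = -1 := by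
  simp [SuperMonomial.parity, superSign, ZMod.val_one]

theorem commute_squareMulLeft (i : Fin p) (j : Fin p ⊕ Fin q) :
    Commute (squareMulLeft K (t (Sum.inl i))) (squareMulLeft K (t j)) := by
  rw [Commute, SemiconjBy, ht.squareMulLeft_mul, superSign_inl, one_smul]

theorem commute_squareMulRight (i : Fin p) (j : Fin p ⊕ Fin q) :
    Commute (squareMulRight K (t (Sum.inl i))) (squareMulRight K (t j)) := by
  rw [Commute, SemiconjBy, ht.squareMulRight_mul, superSign_comm, superSign_inl, one_smul]

theorem squareMulLeft_anticomm (i j : Fin q) :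
    squareMulLeft K (t (Sum.inr i)) * squareMulLeft K (t (Sum.inr j)) =
      -(squareMulLeft K (t (Sum.inr j)) * squareMulLeft K (t (Sum.inr i))) := by
  rw [ht.squareMulLeft_mul, superSign_inr]
  exact neg_one_smul K (_ : Module.End K (algebraSquare K A))

theorem squareMulRight_anticomm (i j : Fin q) :
    squareMulRight K (t (Sum.inr i)) * squareMulRight K (t (Sum.inr j)) =
      -(squareMulRight K (t (Sum.inr j)) * squareMulRight K (t (Sum.inr i))) := by
  rw [ht.squareMulRight_mul, superSign_inr]
  exact neg_one_smul K (_ : Module.End K (algebraSquare K A))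

omit ht in
theorem eq_zero_of_eq_neg_self {V : Type*} [AddCommGroup V] [Module K V] (hK : (2 : K) ≠ 0) {x : V}
    (h : x = -x) : x = 0 := by
  have h2 : (2 : K) • x = 0 := by rw [two_smul]; nth_rewrite 1 [h]; exact neg_add_cancel x
  exact (smul_eq_zero.1 h2).resolve_left hK

variable (K t) in
/-- The multiplications by even generators on both sides of `A ^ 2`. -/
def evenOperator : Fin p ⊕ Fin p → Module.End K (algebraSquare K A) :=
  Sum.elim (fun i => squareMulLeft K (t (Sum.inl i))) fun i => squareMulRight K (t (Sum.inl i))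

theorem commute_evenOperator_left (i : Fin p ⊕ Fin p) (j : Fin p ⊕ Fin q) :
    Commute (evenOperator K t i) (squareMulLeft K (t j)) := by
  rcases i with i | i
  · exact ht.commute_squareMulLeft i j
  · exact (ht.commute_squareMulLeft_squareMulRight j (Sum.inl i)).symm

theorem commute_evenOperator_right (i : Fin p ⊕ Fin p) (j : Fin p ⊕ Fin q) :
    Commute (evenOperator K t i) (squareMulRight K (t j)) := by
  rcases i with i | i
  · exact ht.commute_squareMulLeft_squareMulRight (Sum.inl i) j
  · exact ht.commute_squareMulRight i j

theorem evenOperator_comm (i j : Fin p ⊕ Fin p) :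
    evenOperator K t i * evenOperator K t j = evenOperator K t j * evenOperator K t i := by
  rcases j with j | j
  · exact ht.commute_evenOperator_left i (Sum.inl j)
  · exact ht.commute_evenOperator_right i (Sum.inl j)

variable (K t) in
/-- The products of two generators, acted upon by words in the multiplications by odd generators. -/
def oddGenerators : Set (algebraSquare K A) :=
  {m | ∃ (u v : List (Fin q)) (i j : Fin p ⊕ Fin q),
    (u.map fun k => squareMulLeft K (t (Sum.inr k))).prod
      ((v.map fun k => squareMulRight K (t (Sum.inr k))).prod
        ⟨t i * t j, mul_mem_algebraSquare _ _⟩) = m}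

/-- The only place where characteristic different from `2` matters: anticommuting with itself then
forces an odd operator to square to zero, so words with repeated letters vanish. -/
theorem finite_oddGenerators (hK : (2 : K) ≠ 0) : (oddGenerators K t).Finite := by
  have h1 := finite_range_list_prod (fun k => squareMulLeft K (t (Sum.inr k)))
    ht.squareMulLeft_anticomm fun i => eq_zero_of_eq_neg_self hK (ht.squareMulLeft_anticomm i i)
  have h2 := finite_range_list_prod (fun k => squareMulRight K (t (Sum.inr k)))
    ht.squareMulRight_anticomm fun i => eq_zero_of_eq_neg_self hK (ht.squareMulRight_anticomm i i)
  refine ((h1.prod h2).image2 (fun (x : Module.End K (algebraSquare K A) ×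
    Module.End K (algebraSquare K A)) (y : (Fin p ⊕ Fin q) × (Fin p ⊕ Fin q)) =>
      x.1 (x.2 ⟨t y.1 * t y.2, mul_mem_algebraSquare _ _⟩)) Set.finite_univ).subset ?_
  rintro _ ⟨u, v, i, j, rfl⟩
  exact ⟨(_, _), ⟨⟨u, rfl⟩, ⟨v, rfl⟩⟩, (i, j), trivial, rfl⟩

omit ht in
theorem squareMulLeft_mem_oddGenerators (k : Fin q) {m : algebraSquare K A}
    (hm : m ∈ oddGenerators K t) :
    squareMulLeft K (t (Sum.inr k)) m ∈ oddGenerators K t := by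
  obtain ⟨u, v, i, j, rfl⟩ := hm
  exact ⟨k :: u, v, i, j, by rw [List.map_cons, List.prod_cons, Module.End.mul_apply]⟩

/-- The new right multiplication passes the left word without a sign, so the set itself, and not
just its span, is stable. -/
theorem squareMulRight_mem_oddGenerators (k : Fin q) {m : algebraSquare K A}
    (hm : m ∈ oddGenerators K t) :
    squareMulRight K (t (Sum.inr k)) m ∈ oddGenerators K t := by
  obtain ⟨u, v, i, j, rfl⟩ := hm
  refine ⟨u, k :: v, i, j, ?_⟩
  have h : Commute (u.map fun k => squareMulLeft K (t (Sum.inr k))).prod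
      (squareMulRight K (t (Sum.inr k))) := by
    refine Commute.list_prod_left _ _ fun x hx => ?_
    obtain ⟨l, _, rfl⟩ := List.mem_map.1 hx
    exact ht.commute_squareMulLeft_squareMulRight _ _
  rw [List.map_cons, List.prod_cons, Module.End.mul_apply, ← Module.End.mul_apply, h.eq,
    Module.End.mul_apply]

end IsBicommutativeSystem

end SquareOperators

/-! ### Comparing word growth with the module filtration -/

section SystemGrowth

open MvPolynomial Submodule

variable {K : Type u} [Field K] {A : Type v} [NonUnitalNonAssocRing A] [Module K A]
  [IsScalarTower K A A] [SMulCommClass K A A]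

namespace IsBicommutativeSystem

variable {p q : ℕ} {t : Fin p ⊕ Fin q → A} (ht : IsBicommutativeSystem K t)

include ht

theorem exists_mem_wordSpan (a : A) : ∃ n, a ∈ wordSpan K t n := by
  have ha : a ∈ span K (Set.range (FreeMagma.lift t)) := ht.span_eq_top ▸ mem_top
  induction ha using span_induction with
  | mem a ha =>
    obtain ⟨w, rfl⟩ := ha
    exact ⟨w.length, lift_mem_wordSpan le_rfl⟩
  | zero => exact ⟨0, zero_mem _⟩
  | add x y _ _ hx hy =>
    obtain ⟨a, ha⟩ := hx
    obtain ⟨b, hb⟩ := hy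
    exact ⟨max a b, add_mem (wordSpan_mono K t (le_max_left _ _) ha)
      (wordSpan_mono K t (le_max_right _ _) hb)⟩
  | smul r x _ hx =>
    obtain ⟨a, ha⟩ := hx
    exact ⟨a, Submodule.smul_mem _ _ ha⟩

variable [Module (MvPolynomial (Fin p ⊕ Fin p) K) (algebraSquare K A)]
  [IsScalarTower K (MvPolynomial (Fin p ⊕ Fin p) K) (algebraSquare K A)]
  (hX : ∀ i m, (X i : MvPolynomial (Fin p ⊕ Fin p) K) • m = evenOperator K t i m)
  {G : Finset (algebraSquare K A)} (hG : (G : Set (algebraSquare K A)) = oddGenerators K t)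

include hX hG

/-- An even generator acts as a variable and raises the degree by one. An odd one commutes with the
polynomial action and maps `G` to itself, so it does not raise the degree at all. -/
theorem squareMulLeft_mem_polyFiltration (i : Fin p ⊕ Fin q) {n : ℕ} {m : algebraSquare K A}
    (hm : m ∈ polyFiltration K (Fin p ⊕ Fin p) G n) :
    squareMulLeft K (t i) m ∈ polyFiltration K (Fin p ⊕ Fin p) G (n + 1) := by
  rcases i with i | i
  · have h := smul_mem_polyFiltration_add (f := X (Sum.inl i)) (totalDegree_X _).le hm
    rwa [hX] at h
  · refine polyFiltration_mono G n.le_succ ?_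
    induction hm using span_induction with
    | mem x hx =>
      obtain ⟨f, hf, g, hg, rfl⟩ := hx
      rw [map_smul_of_forall_X (squareMulLeft K (t (Sum.inr i))) fun j m => by
        rw [hX, hX]
        exact LinearMap.congr_fun (ht.commute_evenOperator_left j (Sum.inr i)).symm m]
      refine smul_mem_polyFiltration hf ?_
      rw [← Finset.mem_coe, hG] at hg ⊢
      exact squareMulLeft_mem_oddGenerators i hg
    | zero => simp
    | add x y _ _ hx hy => rw [map_add]; exact add_mem hx hy
    | smul a x _ hx => rw [map_smul]; exact Submodule.smul_mem _ _ hx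

theorem squareMulRight_mem_polyFiltration (i : Fin p ⊕ Fin q) {n : ℕ} {m : algebraSquare K A}
    (hm : m ∈ polyFiltration K (Fin p ⊕ Fin p) G n) :
    squareMulRight K (t i) m ∈ polyFiltration K (Fin p ⊕ Fin p) G (n + 1) := by
  rcases i with i | i
  · have h := smul_mem_polyFiltration_add (f := X (Sum.inr i)) (totalDegree_X _).le hm
    rwa [hX] at h
  · refine polyFiltration_mono G n.le_succ ?_
    induction hm using span_induction with
    | mem x hx =>
      obtain ⟨f, hf, g, hg, rfl⟩ := hx
      rw [map_smul_of_forall_X (squareMulRight K (t (Sum.inr i))) fun j m => by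
        rw [hX, hX]
        exact LinearMap.congr_fun (ht.commute_evenOperator_right j (Sum.inr i)).symm m]
      refine smul_mem_polyFiltration hf ?_
      rw [← Finset.mem_coe, hG] at hg ⊢
      exact ht.squareMulRight_mem_oddGenerators i hg
    | zero => simp
    | add x y _ _ hx hy => rw [map_add]; exact add_mem hx hy
    | smul a x _ hx => rw [map_smul]; exact Submodule.smul_mem _ _ hx

theorem exists_eq_lift_of_isNormalMonomial {w : SuperMonomial p q} (hw : IsNormalMonomial w) :
    ∃ m ∈ polyFiltration K (Fin p ⊕ Fin p) G w.length,
      (m : A) = FreeMagma.lift t w := by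
  induction hw with
  | base i j =>
    refine ⟨⟨t i * t j, mul_mem_algebraSquare _ _⟩, polyFiltration_mono G (Nat.zero_le _)
      (mem_polyFiltration_zero ?_), rfl⟩
    rw [← Finset.mem_coe, hG]
    -- Empty odd words: the plain products of two generators belong to `G`.
    exact ⟨[], [], i, j, rfl⟩
  | left i w _ ih =>
    obtain ⟨m, hm, h⟩ := ih
    refine ⟨_, ?_, (coe_squareMulLeft (K := K) (t i) m).trans ?_⟩
    · rw [freeMagma_length_mul, add_comm]
      exact ht.squareMulLeft_mem_polyFiltration hX hG i hm
    · rw [h, map_mul, FreeMagma.lift_of]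
  | right i w _ ih =>
    obtain ⟨m, hm, h⟩ := ih
    refine ⟨_, ?_, (coe_squareMulRight (K := K) (t i) m).trans ?_⟩
    · rw [freeMagma_length_mul]
      exact ht.squareMulRight_mem_polyFiltration hX hG i hm
    · rw [h, map_mul, FreeMagma.lift_of]

theorem exists_eq_lift_mul (x y : SuperMonomial p q) :
    ∃ m ∈ polyFiltration K (Fin p ⊕ Fin p) G (x * y).length,
      (m : A) = FreeMagma.lift t (x * y) := by
  obtain ⟨n, c, hn, hl, h⟩ := ht.hasNormalForm_mul x y
  obtain ⟨m, hm, h'⟩ := ht.exists_eq_lift_of_isNormalMonomial hX hG hn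
  exact ⟨c • m, Submodule.smul_mem _ _ (hl ▸ hm), by rw [h, ← h']; rfl⟩

theorem span_oddGenerators_eq_top :
    span (MvPolynomial (Fin p ⊕ Fin p) K) (G : Set (algebraSquare K A)) = ⊤ := by
  set N := span (MvPolynomial (Fin p ⊕ Fin p) K) (G : Set (algebraSquare K A))
  have hle : algebraSquare K A ≤ (N.restrictScalars K).map (algebraSquare K A).subtype := by
    refine span_le.2 ?_
    rintro _ ⟨a, b, rfl⟩
    have ha : a ∈ span K (Set.range (FreeMagma.lift t)) := ht.span_eq_top ▸ mem_top
    have hb : b ∈ span K (Set.range (FreeMagma.lift t)) := ht.span_eq_top ▸ mem_top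
    refine mul_mem_of_forall_mem_span ?_ ha hb
    rintro _ ⟨x, rfl⟩ _ ⟨y, rfl⟩
    obtain ⟨m, hm, h⟩ := ht.exists_eq_lift_mul hX hG x y
    refine ⟨m, ?_, by rw [← map_mul]; exact h⟩
    refine (span_le (p := N.restrictScalars K)).2 ?_ hm
    rintro _ ⟨f, _, g, hg, rfl⟩
    exact N.smul_mem f (subset_span hg)
  refine eq_top_iff.2 fun m _ => ?_
  obtain ⟨m', hm', h⟩ := hle m.2
  rwa [← Subtype.ext h]

/-- The summand `1` pays for a possible identity element and `p + q` for the words of length one;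
all longer words lie in `A ^ 2`. -/
theorem growthFunction_le {S : Finset A} (hS : Set.range t = S) (n : ℕ) :
    growthFunction K S n ≤
      1 + (p + q) + Module.finrank K (polyFiltration K (Fin p ⊕ Fin p) G n) := by
  have hle : wordSpan K t n ≤ span K (Set.range t) ⊔
      (polyFiltration K (Fin p ⊕ Fin p) G n).map (algebraSquare K A).subtype := by
    refine span_le.2 ?_
    rintro _ ⟨w, hw, rfl⟩
    cases w with
    | of i => exact mem_sup_left (subset_span ⟨i, rfl⟩)
    | mul x y =>
      obtain ⟨m, hm, h⟩ := ht.exists_eq_lift_mul hX hG x y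
      exact mem_sup_right ⟨m, polyFiltration_mono G hw hm, h⟩
  have := FiniteDimensional.span_of_finite K (Set.finite_range t)
  rw [growthFunction_eq_finrank, growthSpan_eq hS]
  refine (Submodule.finrank_add_le_finrank_add_finrank _ _).trans ?_
  rw [add_assoc]
  refine Nat.add_le_add (finrank_span_identityElements_le K) ((finrank_mono hle).trans ?_)
  refine (Submodule.finrank_add_le_finrank_add_finrank _ _).trans ?_
  refine Nat.add_le_add ((finrank_range_le_card t).trans (by simp)) (finrank_map_le _ _)

/-- Conversely, the finitely many elements of `G` are reached by words of some length `c`, and each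
variable, being multiplication by a generator, adds one letter. -/
theorem exists_finrank_polyFiltration_le {S : Finset A} (hS : Set.range t = S) :
    ∃ c, ∀ n, Module.finrank K (polyFiltration K (Fin p ⊕ Fin p) G n) ≤
      growthFunction K S (c + n) := by
  obtain ⟨c, hc⟩ := exists_forall_mem_of_finite (wordSpan_mono K t)
    (fun g : G => ((g : algebraSquare K A) : A)) fun g => ht.exists_mem_wordSpan _
  let F : ℕ → Submodule K (algebraSquare K A) := fun n =>
    (wordSpan K t n).comap (algebraSquare K A).subtype
  have hF : ∀ (i : Fin p ⊕ Fin p) k m, m ∈ F k →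
      (X i : MvPolynomial (Fin p ⊕ Fin p) K) • m ∈ F (k + 1) := by
    intro i k m hm
    rw [hX]
    rcases i with i | i
    · rw [add_comm]
      exact mul_mem_wordSpan (lift_mem_wordSpan (w := FreeMagma.of (Sum.inl i)) le_rfl) hm
    · exact mul_mem_wordSpan hm (lift_mem_wordSpan (w := FreeMagma.of (Sum.inl i)) le_rfl)
  refine ⟨c, fun n => ?_⟩
  rw [← finrank_map_subtype_eq, growthFunction_eq_finrank]
  refine finrank_mono (map_le_iff_le_comap.2 (span_le.2 ?_))
  rintro _ ⟨f, hf, g, hg, rfl⟩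
  have h := smul_mem_of_totalDegree_le (F := F) (fun a b h => comap_mono (wordSpan_mono K t h)) hF
    hf (hc ⟨g, hg⟩)
  rw [one_mul] at h
  rw [growthSpan_eq hS]
  exact mem_sup_right h

omit [Module (MvPolynomial (Fin p ⊕ Fin p) K) (algebraSquare K A)]
  [IsScalarTower K (MvPolynomial (Fin p ⊕ Fin p) K) (algebraSquare K A)] hX hG in
theorem growth (hK : (2 : K) ≠ 0) {S : Finset A} (hS : Set.range t = S) :
    (∃ d, HasPolynomialGrowth (growthFunction K S) d) ∧
      ∃ C, ∀ n, growthFunction K S n ≤ C * (n + 1) ^ (2 * p) := by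
  obtain ⟨_, _, hX⟩ := exists_module_of_commute (evenOperator K t) ht.evenOperator_comm
  obtain ⟨G, hG⟩ := (ht.finite_oddGenerators hK).exists_finset_coe
  have h₁ := ht.growthFunction_le hX hG hS
  constructor
  · obtain ⟨d, hd⟩ := exists_hasPolynomialGrowth_polyFiltration
      (ht.span_oddGenerators_eq_top hX hG)
    obtain ⟨c, hc⟩ := ht.exists_finrank_polyFiltration_le hX hG hS
    refine ⟨d, hd.of_comparable (growthFunction_mono S) (a := 1 + (p + q)) (c := c + 1)
      (fun n => (h₁ n).trans (Nat.add_le_add_left ?_ _)) fun n => (hc n).trans ?_⟩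
    · exact finrank_mono (polyFiltration_mono G (by nlinarith))
    · exact growthFunction_mono S (by nlinarith)
  · refine ⟨1 + (p + q) + G.card, fun n => (h₁ n).trans ?_⟩
    have h2 := finrank_polyFiltration_le (K := K) (σ := Fin p ⊕ Fin p) G n
    rw [Fintype.card_sum, Fintype.card_fin, ← two_mul] at h2
    rw [add_mul]
    exact Nat.add_le_add (Nat.le_mul_of_pos_right _ (by positivity)) h2

end IsBicommutativeSystem

end SystemGrowth

/-! ### Homogeneous generating systems -/

section HomogeneousGenerators

open Submodule

variable {K : Type u} [Field K] {A : Type v} [NonUnitalNonAssocRing A] [Module K A]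

theorem IsSuperalgebra.exists_add_eq {𝒜 : ZMod 2 → Submodule K A} (h : IsSuperalgebra 𝒜) (a : A) :
    ∃ x ∈ 𝒜 0, ∃ y ∈ 𝒜 1, x + y = a := by
  refine mem_sup.1 ?_
  have hle : iSup 𝒜 ≤ 𝒜 0 ⊔ 𝒜 1 := iSup_le fun i => by
    fin_cases i
    · exact le_sup_left
    · exact le_sup_right
  exact hle (h.isInternal.submodule_iSup_eq_top ▸ mem_top)

variable [IsScalarTower K A A] [SMulCommClass K A A]

/-- Each generator is replaced by its even and odd components, which is why there are equally many
of both kinds (some possibly zero). Identity elements are put among the generators, so that nonempty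
words alone span `A`. -/
theorem IsBicommutativeSuperalgebra.exists_isBicommutativeSystem {𝒜 : ZMod 2 → Submodule K A}
    (h : IsBicommutativeSuperalgebra 𝒜) (hA : IsFinitelyGenerated K A) :
    ∃ (n : ℕ) (t : Fin n ⊕ Fin n → A), IsBicommutativeSystem K t := by
  obtain ⟨S, hS⟩ := hA
  have hfin := S.finite_toSet.union (subsingleton_identityElements (A := A)).finite
  obtain ⟨n, b, hb⟩ := hfin.fin_param
  choose x hx y hy hxy using fun i => h.exists_add_eq (b i)
  let t : Fin n ⊕ Fin n → A := Sum.elim x y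
  have hdeg : ∀ w : SuperMonomial n n, FreeMagma.lift t w ∈ 𝒜 w.parity := by
    intro w
    induction w using FreeMagma.recOnMul with
    | ih1 i =>
      rcases i with i | i
      · exact hx i
      · exact hy i
    | ih2 u v hu hv =>
      rw [map_mul]
      exact h.mul_mem _ _ _ _ hu hv
  refine ⟨n, t, ?_, fun u v w => ?_, fun u v w => ?_⟩
  · rw [eq_top_iff]
    intro a _
    have ha : a ∈ NonUnitalAlgebra.adjoin K ((S : Set A) ∪ identityElements A) := by
      rw [show NonUnitalAlgebra.adjoin K ((S : Set A) ∪ identityElements A) = ⊤ from hS]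
      trivial
    induction ha using NonUnitalAlgebra.adjoin_induction with
    | mem a ha =>
      rw [← hb.2] at ha
      obtain ⟨i, rfl⟩ := ha
      rw [← hxy]
      exact add_mem (subset_span ⟨FreeMagma.of (Sum.inl i), rfl⟩)
        (subset_span ⟨FreeMagma.of (Sum.inr i), rfl⟩)
    | zero => exact zero_mem _
    | add a b _ _ ha hb => exact add_mem (ha trivial) (hb trivial)
    | mul a b _ _ ha hb =>
      refine mul_mem_of_forall_mem_span ?_ (ha trivial) (hb trivial)
      rintro _ ⟨u, rfl⟩ _ ⟨v, rfl⟩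
      exact subset_span ⟨u * v, map_mul _ _ _⟩
    | smul r a _ ha => exact Submodule.smul_mem _ _ (ha trivial)
  · simp only [map_mul]
    exact h.left_comm _ _ _ _ _ _ (hdeg u) (hdeg v) (hdeg w)
  · simp only [map_mul]
    exact h.right_comm _ _ _ _ _ _ (hdeg u) (hdeg v) (hdeg w)

theorem IsBicommutativeSystem.isGeneratingSystem {p q : ℕ} {t : Fin p ⊕ Fin q → A}
    (ht : IsBicommutativeSystem K t) {S : Finset A} (hS : Set.range t = S) :
    IsGeneratingSystem K S := isGeneratingSystem_of_span_eq_top hS ht.span_eq_top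

end HomogeneousGenerators

/-! ### A polynomial model for the lower bound -/

section BicommutativeModel

/-- The product of two copies of a commutative ring, with the bicommutative multiplication
`(a, b) (c, d) = (a d, a d)`. -/
def BicommutativeModel (C : Type u) : Type u := C × C

namespace BicommutativeModel

variable (K : Type u) [Field K] (C : Type v) [CommRing C] [Algebra K C]

instance : AddCommGroup (BicommutativeModel C) := inferInstanceAs (AddCommGroup (C × C))

instance : Module K (BicommutativeModel C) := inferInstanceAs (Module K (C × C))

instance : Mul (BicommutativeModel C) where
  mul a b := (a.1 * b.2, a.1 * b.2)

instance : NonUnitalNonAssocRing (BicommutativeModel C) :=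
  { (inferInstance : AddCommGroup (BicommutativeModel C)),
    (inferInstance : Mul (BicommutativeModel C)) with
    left_distrib := fun a b c => Prod.ext (mul_add a.1 b.2 c.2) (mul_add a.1 b.2 c.2)
    right_distrib := fun a b c => Prod.ext (add_mul a.1 b.1 c.2) (add_mul a.1 b.1 c.2)
    zero_mul := fun a => Prod.ext (zero_mul a.2) (zero_mul a.2)
    mul_zero := fun a => Prod.ext (mul_zero a.1) (mul_zero a.1) }

instance : IsScalarTower K (BicommutativeModel C) (BicommutativeModel C) where
  smul_assoc k a b := Prod.ext (smul_mul_assoc k a.1 b.2) (smul_mul_assoc k a.1 b.2)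

instance : SMulCommClass K (BicommutativeModel C) (BicommutativeModel C) where
  smul_comm k a b := Prod.ext (mul_smul_comm k a.1 b.2).symm (mul_smul_comm k a.1 b.2).symm

variable {C}

theorem mul_left_comm' (a b c : BicommutativeModel C) : a * (b * c) = b * (a * c) :=
  Prod.ext (mul_left_comm a.1 b.1 c.2) (mul_left_comm a.1 b.1 c.2)

theorem mul_right_comm' (a b c : BicommutativeModel C) : (a * b) * c = (a * c) * b :=
  Prod.ext (mul_right_comm a.1 b.2 c.2) (mul_right_comm a.1 b.2 c.2)

end BicommutativeModel

end BicommutativeModel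

/-! ### Growth of the free bicommutative superalgebra -/

namespace FreeBicommutativeSuperalgebra

open Submodule

variable (K : Type u) [Field K] (p q : ℕ)

/-- The free generators. -/
noncomputable def generator (i : Fin p ⊕ Fin q) : FreeBicommutativeSuperalgebra K p q :=
  mk K p q (FreeNonUnitalNonAssocAlgebra.of K i)

theorem lift_generator (w : SuperMonomial p q) :
    FreeMagma.lift (generator K p q) w = mk K p q (SuperMonomial.toFree K p q w) := by
  induction w using FreeMagma.recOnMul with
  | ih1 i => rfl
  | ih2 u v hu hv => rw [map_mul, map_mul, mk_mul, hu, hv]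

theorem toFree_eq_single (w : SuperMonomial p q) :
    SuperMonomial.toFree K p q w = MonoidAlgebra.ofMagma K _ w := by
  induction w using FreeMagma.recOnMul with
  | ih1 i => rfl
  | ih2 u v hu hv => rw [map_mul, map_mul, hu, hv]

theorem span_range_toFree : span K (Set.range (SuperMonomial.toFree K p q)) = ⊤ := by
  rw [eq_top_iff]
  intro x _
  induction x using MonoidAlgebra.induction_linear with
  | zero => exact zero_mem _
  | add f g hf hg => exact add_mem (hf trivial) (hg trivial)
  | single w r =>
    have h : (MonoidAlgebra.single w r : FreeNonUnitalNonAssocAlgebra K (Fin p ⊕ Fin q)) =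
        r • SuperMonomial.toFree K p q w := by
      rw [toFree_eq_single]
      simp [MonoidAlgebra.ofMagma]
    rw [h]
    exact Submodule.smul_mem _ _ (subset_span ⟨w, rfl⟩)

theorem bicommutativeRelations_subset : bicommutativeRelations K p q ⊆ bicommutativeIdeal K p q :=
  fun _ hr => mem_sInf.2 fun _ hJ => hJ.1 hr

theorem isBicommutativeSystem_generator : IsBicommutativeSystem K (generator K p q) where
  span_eq_top := by
    have h : Set.range (FreeMagma.lift (generator K p q)) =
        mk K p q '' Set.range (SuperMonomial.toFree K p q) := by
      rw [← Set.range_comp]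
      exact congrArg Set.range (funext fun w => lift_generator K p q w)
    rw [h, span_image, span_range_toFree, Submodule.map_top, LinearMap.range_eq_top]
    exact mk_surjective K p q
  left_comm x y z := by
    rw [lift_generator, lift_generator, ← map_smul, mk_eq_mk_iff]
    exact bicommutativeRelations_subset K p q ⟨x, y, z, Or.inl rfl⟩
  right_comm x y z := by
    rw [lift_generator, lift_generator, ← map_smul, mk_eq_mk_iff]
    exact bicommutativeRelations_subset K p q ⟨x, y, z, Or.inr rfl⟩

open MvPolynomial in
/-- The images of the free generators in the polynomial model: the odd ones are killed. -/
noncomputable def modelGenerator :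
    Fin p ⊕ Fin q → BicommutativeModel (MvPolynomial (Fin p ⊕ Fin p) K) :=
  Sum.elim (fun i => (X (Sum.inl i), X (Sum.inr i))) 0

variable {p q} in
-- The model satisfies the identities without signs. Monomials of odd parity vanish there, so each
-- super-identity either holds trivially or carries the sign `1`.
theorem lift_modelGenerator_eq_zero_or (w : SuperMonomial p q) :
    FreeMagma.lift (modelGenerator K p q) w = 0 ∨ w.parity = 0 := by
  induction w using FreeMagma.recOnMul with
  | ih1 i =>
    rcases i with i | i
    · exact Or.inr rfl
    · exact Or.inl rfl
  | ih2 u v hu hv =>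
    rcases hu with hu | hu
    · exact Or.inl (by rw [map_mul, hu, zero_mul])
    · rcases hv with hv | hv
      · exact Or.inl (by rw [map_mul, hv, mul_zero])
      · exact Or.inr (by
          change SuperMonomial.parity u + SuperMonomial.parity v = 0
          rw [hu, hv, add_zero])

theorem lift_modelGenerator_left_comm (x y z : SuperMonomial p q) :
    FreeMagma.lift (modelGenerator K p q) (x * (y * z)) =
      superSign K x.parity y.parity • FreeMagma.lift (modelGenerator K p q) (y * (x * z)) := by
  simp only [map_mul]
  rcases lift_modelGenerator_eq_zero_or K x with h | h
  · simp [h]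
  · rw [BicommutativeModel.mul_left_comm', h]
    simp [superSign]

theorem lift_modelGenerator_right_comm (x y z : SuperMonomial p q) :
    FreeMagma.lift (modelGenerator K p q) ((x * y) * z) =
      superSign K y.parity z.parity • FreeMagma.lift (modelGenerator K p q) ((x * z) * y) := by
  simp only [map_mul]
  rcases lift_modelGenerator_eq_zero_or K y with h | h
  · simp [h]
  · rw [BicommutativeModel.mul_right_comm', h]
    simp [superSign]

theorem lift_toFree (w : SuperMonomial p q) :
    FreeNonUnitalNonAssocAlgebra.lift K (modelGenerator K p q) (SuperMonomial.toFree K p q w) =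
      FreeMagma.lift (modelGenerator K p q) w := by
  induction w using FreeMagma.recOnMul with
  | ih1 i => exact FreeNonUnitalNonAssocAlgebra.lift_of_apply K (modelGenerator K p q) i
  | ih2 u v hu hv => rw [map_mul, map_mul, map_mul, hu, hv]

theorem bicommutativeIdeal_le_ker : bicommutativeIdeal K p q ≤ LinearMap.ker
    (FreeNonUnitalNonAssocAlgebra.lift K (modelGenerator K p q) :
      FreeNonUnitalNonAssocAlgebra K (Fin p ⊕ Fin q) →ₗ[K]
        BicommutativeModel (MvPolynomial (Fin p ⊕ Fin p) K)) := by
  refine sInf_le ⟨?_, fun a b hb => ?_⟩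
  · rintro _ ⟨x, y, z, rfl | rfl⟩
    · refine LinearMap.mem_ker.2 ((map_sub _ _ _).trans (sub_eq_zero.2 ?_))
      refine Eq.trans ?_ (map_smul _ _ _).symm
      exact ((lift_toFree K p q _).trans (lift_modelGenerator_left_comm K p q x y z)).trans
        (congrArg _ (lift_toFree K p q _).symm)
    · refine LinearMap.mem_ker.2 ((map_sub _ _ _).trans (sub_eq_zero.2 ?_))
      refine Eq.trans ?_ (map_smul _ _ _).symm
      exact ((lift_toFree K p q _).trans (lift_modelGenerator_right_comm K p q x y z)).trans
        (congrArg _ (lift_toFree K p q _).symm)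
  · have hb' : FreeNonUnitalNonAssocAlgebra.lift K (modelGenerator K p q) b = 0 := hb
    constructor
    · refine (map_mul (FreeNonUnitalNonAssocAlgebra.lift K (modelGenerator K p q)) a b).trans ?_
      rw [hb', mul_zero]
    · refine (map_mul (FreeNonUnitalNonAssocAlgebra.lift K (modelGenerator K p q)) b a).trans ?_
      rw [hb', zero_mul]

/-- The map to the polynomial model. -/
noncomputable def toModel : FreeBicommutativeSuperalgebra K p q →ₗ[K]
    BicommutativeModel (MvPolynomial (Fin p ⊕ Fin p) K) :=
  (bicommutativeIdeal K p q).liftQ _ (bicommutativeIdeal_le_ker K p q)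

theorem toModel_lift (w : SuperMonomial p q) :
    toModel K p q (FreeMagma.lift (generator K p q) w) =
      FreeMagma.lift (modelGenerator K p q) w := by
  rw [lift_generator, ← lift_toFree]
  rfl

open MvPolynomial

/-- On pairs with equal coordinates, left multiplication by the even generator `i` multiplies by `X
(inl i)` and right multiplication by `X (inr i)`; every monomial is thus realized, one letter per
degree. -/
theorem exists_lift_modelGenerator_eq (s : Fin p ⊕ Fin p →₀ ℕ) :
    ∀ (w : SuperMonomial p q) (c : MvPolynomial (Fin p ⊕ Fin p) K),
      FreeMagma.lift (modelGenerator K p q) w = (c, c) →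
      ∃ w' : SuperMonomial p q, w'.length = w.length + s.degree ∧
        FreeMagma.lift (modelGenerator K p q) w' = (monomial s 1 * c, monomial s 1 * c) := by
  induction s using Finsupp.induction_linear with
  | zero =>
    intro w c hw
    refine ⟨w, by simp, ?_⟩
    rw [hw, monomial_zero', C_1, one_mul]
  | add s s' hs hs' =>
    intro w c hw
    obtain ⟨w₁, hl₁, h₁⟩ := hs w c hw
    obtain ⟨w₂, hl₂, h₂⟩ := hs' w₁ _ h₁
    refine ⟨w₂, by rw [hl₂, hl₁, map_add, add_assoc], ?_⟩
    rw [h₂, ← mul_assoc, monomial_mul, one_mul, add_comm]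
  | single i n =>
    intro w c hw
    rw [← X_pow_eq_monomial, Finsupp.degree_single]
    induction n with
    | zero => exact ⟨w, rfl, by rw [hw, pow_zero, one_mul]⟩
    | succ n ih =>
      obtain ⟨w', hl, h⟩ := ih
      rcases i with i | i
      · refine ⟨FreeMagma.of (Sum.inl i) * w', ?_, ?_⟩
        · rw [freeMagma_length_mul, hl, FreeMagma.length]; omega
        · rw [map_mul, h, FreeMagma.lift_of, pow_succ', mul_assoc]
          rfl
      · refine ⟨w' * FreeMagma.of (Sum.inl i), ?_, ?_⟩
        · rw [freeMagma_length_mul, hl, FreeMagma.length]; omega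
        · rw [map_mul, h, FreeMagma.lift_of, pow_succ, mul_right_comm]
          rfl

theorem pow_le_growthFunction (hp : 0 < p) {S : Finset (FreeBicommutativeSuperalgebra K p q)}
    (hS : Set.range (generator K p q) = S) (n : ℕ) :
    n ^ (2 * p) ≤ growthFunction K S (2 + 2 * p * n) := by
  let o : Fin p ⊕ Fin q := Sum.inl ⟨0, hp⟩
  -- The value of the square of the first even generator: products already have equal coordinates,
  -- and `0 < p` is needed to form one.
  let c : MvPolynomial (Fin p ⊕ Fin p) K := X (Sum.inl ⟨0, hp⟩) * X (Sum.inr ⟨0, hp⟩)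
  have hc : c ≠ 0 := mul_ne_zero (X_ne_zero _) (X_ne_zero _)
  choose w hl hw using fun s : Fin p ⊕ Fin p → Fin n => exists_lift_modelGenerator_eq K p q
    (Finsupp.equivFunOnFinite.symm fun i => (s i : ℕ)) (FreeMagma.of o * FreeMagma.of o) c rfl
  have hmem : ∀ s, FreeMagma.lift (generator K p q) (w s) ∈ growthSpan K S (2 + 2 * p * n) := by
    intro s
    rw [growthSpan_eq hS]
    refine mem_sup_right (lift_mem_wordSpan ?_)
    have h := degree_box_le s
    rw [Fintype.card_sum, Fintype.card_fin, ← two_mul] at h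
    rw [hl]
    exact Nat.add_le_add_left h 2
  let v : (Fin p ⊕ Fin p → Fin n) → growthSpan K S (2 + 2 * p * n) := fun s => ⟨_, hmem s⟩
  let π : growthSpan K S (2 + 2 * p * n) →ₗ[K] MvPolynomial (Fin p ⊕ Fin p) K :=
    (LinearMap.fst K _ _ ∘ₗ toModel K p q) ∘ₗ Submodule.subtype _
  have hv : LinearIndependent K v := by
    refine LinearIndependent.of_comp π ?_
    -- Multiplication by `c ≠ 0` is injective in the polynomial domain, so the images stay
    -- independent.
    have h := (linearIndependent_boxMonomials K (Fin p ⊕ Fin p) n).map' (LinearMap.mulRight K c)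
      (LinearMap.ker_eq_bot.2 (mul_left_injective₀ hc))
    have heq : (π ∘ v) = LinearMap.mulRight K c ∘ fun s =>
        monomial (Finsupp.equivFunOnFinite.symm fun i => (s i : ℕ)) (1 : K) := by
      funext s
      exact congrArg Prod.fst ((toModel_lift K p q (w s)).trans (hw s))
    rw [heq]
    exact h
  classical
  have h := hv.fintype_card_le_finrank
  rw [growthFunction_eq_finrank]
  simpa [← two_mul] using h

theorem hasPolynomialGrowth (hK : (2 : K) ≠ 0)
    {S : Finset (FreeBicommutativeSuperalgebra K p q)}
    (hS : Set.range (generator K p q) = S) : HasPolynomialGrowth (growthFunction K S) (2 * p) := by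
  obtain ⟨C, hC⟩ := ((isBicommutativeSystem_generator K p q).growth hK hS).2
  refine ⟨C + (2 + 2 * p), fun n => (hC n).trans ?_, ?_⟩
  · gcongr
    omega
  -- Without even generators the exponent is `0`, and no lower bound is required.
  · rcases Nat.eq_zero_or_pos p with rfl | hp
    · exact Or.inl rfl
    · refine Or.inr fun n => (pow_le_growthFunction K p q hp hS n).trans ?_
      refine (growthFunction_mono S ?_).trans (Nat.le_mul_of_pos_left _ (by omega))
      nlinarith [Nat.zero_le (C * (n + 1))]

end FreeBicommutativeSuperalgebra

/-! ### The theorem -/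

theorem theorem4p11 (K : Type u) [Field K] (hK : ringChar K ≠ 2) :
    (∀ (A : Type v) [NonUnitalNonAssocRing A] [Module K A] [IsScalarTower K A A]
        [SMulCommClass K A A] (𝒜 : ZMod 2 → Submodule K A),
        IsBicommutativeSuperalgebra 𝒜 → IsFinitelyGenerated K A →
          ∃ d : ℕ, HasGKDim K A (d : EReal)) ∧
      ∀ p q : ℕ, HasGKDim K (FreeBicommutativeSuperalgebra K p q) ((2 * p : ℕ) : EReal) := by
  have h2 : (2 : K) ≠ 0 := Ring.two_ne_zero hK
  refine ⟨fun A _ _ _ _ 𝒜 h𝒜 hA => ?_, fun p q => ?_⟩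
  · obtain ⟨n, t, ht⟩ := h𝒜.exists_isBicommutativeSystem hA
    obtain ⟨S, hS⟩ := (Set.finite_range t).exists_finset_coe
    obtain ⟨d, hd⟩ := (ht.growth h2 hS.symm).1
    exact ⟨d, hasGKDim_of_hasPolynomialGrowth (ht.isGeneratingSystem hS.symm) hd⟩
  · obtain ⟨S, hS⟩ :=
      (Set.finite_range (FreeBicommutativeSuperalgebra.generator K p q)).exists_finset_coe
    have ht := FreeBicommutativeSuperalgebra.isBicommutativeSystem_generator K p q
    exact hasGKDim_of_hasPolynomialGrowth (ht.isGeneratingSystem hS.symm)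
      (FreeBicommutativeSuperalgebra.hasPolynomialGrowth K p q h2 hS.symm)
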